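/- Let $(\xi_n)_{n\in\mathbb Z}$ be a (strictly) stationary Markov chain defined on a probability space $(\Omega,\mathcal F,\mathbb P)$ with values in an arbitrary measurable space $(S,\mathcal A)$, and let $\pi$ be the law of $\xi_0$. Assume that the chain is totally ergodic: if $\theta$ denotes the shift $(x_k)_{k\in\mathbb Z}\mapsto(x_{k+1})_{k\in\mathbb Z}$ on $S^{\mathbb Z}$, then for every integer $m\ge 1$ the transformation $\theta^m$ is ergodic with respect to the law of $(\xi_n)_{n\in\mathbb Z}$ on $S^{\mathbb Z}$. Let $f:S\to\mathbb R$ be measurable with $\int f^2\,d\pi<\infty$ and $\int f\,d\pi=0$, and set $X_i=f(\xi_i)$ and $S_n=\sum_{i=1}^n X_i$. Assume that $$\sup_{n\ge 1}\frac{E(S_n^2)}{n}<\infty .$$ Then, with $\|\cdot\|$ the norm of $L^2(\Omega,\mathcal F,\mathbb P)$, the limit $$\sigma^2=\lim_{n\to\infty}\frac1n\,\bigl\|S_n-E(S_n\mid\xi_0,\xi_n)\bigr\|^2$$ exists in $[0,\infty)$, and $$\frac{S_n-E(S_n\mid\xi_0,\xi_n)}{\sqrt n}\Rightarrow N(0,\sigma^2)\qquad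 (n\to\infty),$$ where $\Rightarrow$ denotes convergence in distribution and $N(0,0)$ is the point mass at $0$. -/

import Mathlib

open MeasureTheory ProbabilityTheory Filter Topology
open scoped NNReal

namespace RandomCentering

variable {Ω S : Type*} [MeasurableSpace Ω] [MeasurableSpace S]

/-- The left shift on two-sided sequences. -/
def shift (x : ℤ → S) : ℤ → S := fun k => x (k + 1)

/-- The law on the path space `ℤ → S` (with the product sigma-algebra) of a two-sided process. -/
noncomputable def pathLaw (μ : Measure Ω) (ξ : ℤ → Ω → S) : Measure (ℤ → S) :=
  μ.map (fun ω k => ξ k ω)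

/-- The sigma-algebra generated by `ξ k`, `k ≤ n`. -/
abbrev past (ξ : ℤ → Ω → S) (n : ℤ) : MeasurableSpace Ω :=
  ⨆ k : ℤ, ⨆ _ : k ≤ n, MeasurableSpace.comap (ξ k) inferInstance

/-- The sigma-algebra generated by the two variables `ξ i` and `ξ j`. -/
abbrev pairSigma (ξ : ℤ → Ω → S) (i j : ℤ) : MeasurableSpace Ω :=
  MeasurableSpace.comap (ξ i) inferInstance ⊔ MeasurableSpace.comap (ξ j) inferInstance

/-- `ξ` is a (strictly) stationary Markov chain indexed by `ℤ`: the law of the whole process is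
invariant under the shift, and the conditional probability of `ξ (n + 1) ∈ A` given the whole past
up to time `n` coincides with the one given `ξ n`. -/
structure IsStationaryMarkovChain (μ : Measure Ω) (ξ : ℤ → Ω → S) : Prop where
  measurable : ∀ n, Measurable (ξ n)
  stationary : MeasurePreserving shift (pathLaw μ ξ) (pathLaw μ ξ)
  markov : ∀ (n : ℤ) (A : Set S), MeasurableSet A →
    μ[(ξ (n + 1) ⁻¹' A).indicator (fun _ => (1 : ℝ)) | past ξ n] =ᵐ[μ]
      μ[(ξ (n + 1) ⁻¹' A).indicator (fun _ => (1 : ℝ)) |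
        MeasurableSpace.comap (ξ n) inferInstance]

/-- A transformation is totally ergodic if each of its powers `T ^ m`, `m ≥ 1`, is ergodic. -/
def IsTotallyErgodic {α : Type*} [MeasurableSpace α] (T : α → α) (ν : Measure α) : Prop :=
  ∀ m : ℕ, 1 ≤ m → Ergodic T^[m] ν

/-- The partial sums `f (ξ 1) + ... + f (ξ n)`. -/
noncomputable def partialSum (f : S → ℝ) (ξ : ℤ → Ω → S) (n : ℕ) (ω : Ω) : ℝ :=
  ∑ i ∈ Finset.Icc 1 n, f (ξ (i : ℤ) ω)

/-- The randomly centered partial sum `S_n - E(S_n | ξ 0, ξ n)`. -/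
noncomputable def centeredSum (μ : Measure Ω) (f : S → ℝ) (ξ : ℤ → Ω → S) (n : ℕ) (ω : Ω) : ℝ :=
  partialSum f ξ n ω - (μ[partialSum f ξ n | pairSigma ξ 0 (n : ℤ)]) ω

end RandomCentering

namespace RandomCentering

section ConditionalExpectation

variable {Ω Ω' : Type*} {m m' m1 m2 m3 F F' s s' G : MeasurableSpace Ω} {n : MeasurableSpace Ω'}
  {m0 : MeasurableSpace Ω} {m0' : MeasurableSpace Ω'} {μ : Measure Ω} {ν : Measure Ω'}

/-- Conditional expectations commute with measure preserving maps. -/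
theorem condExp_comp_measurePreserving [IsFiniteMeasure μ] [IsFiniteMeasure ν] {Φ : Ω → Ω'}
    (hΦ : MeasurePreserving Φ μ ν) (hm : n ≤ m0') {g : Ω' → ℝ}
    (hg : Integrable g ν) :
    μ[g ∘ Φ | n.comap Φ] =ᵐ[μ] (ν[g | n]) ∘ Φ := by
  have hmc : n.comap Φ ≤ m0 := (MeasurableSpace.comap_mono hm).trans hΦ.measurable.comap_le
  have hsm : StronglyMeasurable[n.comap Φ] ((ν[g | n]) ∘ Φ) :=
    stronglyMeasurable_condExp.comp_measurable (comap_measurable Φ)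
  symm
  refine ae_eq_condExp_of_forall_setIntegral_eq hmc (hΦ.integrable_comp_of_integrable hg)
    (fun s _ _ => (hΦ.integrable_comp_of_integrable integrable_condExp).integrableOn) ?_
    hsm.aestronglyMeasurable
  rintro s ⟨t, ht, rfl⟩ -
  have key : ∀ h : Ω' → ℝ, Integrable h ν →
      ∫ x in Φ ⁻¹' t, (h ∘ Φ) x ∂μ = ∫ y in t, h y ∂ν := by
    intro h hh
    rw [← hΦ.map_eq, setIntegral_map (hm t ht) _ hΦ.measurable.aemeasurable]
    · rfl
    · rw [hΦ.map_eq]; exact hh.aestronglyMeasurable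
  rw [key _ integrable_condExp, key _ hg, setIntegral_condExp hm hg ht]

theorem integral_mul_condExp_comm [IsFiniteMeasure μ] (hm : m ≤ m0)
    {Z Y : Ω → ℝ} (hZ : AEStronglyMeasurable Z μ) {R : ℝ≥0} (hR : ∀ x, |Z x| ≤ R)
    (hY : Integrable Y μ) :
    ∫ x, Z x * (μ[Y | m]) x ∂μ = ∫ x, (μ[Z | m]) x * Y x ∂μ := by
  have hZi : Integrable Z μ := Integrable.of_bound hZ R (ae_of_all _ hR)
  have hb : ∀ᵐ x ∂μ, ‖(μ[Z | m]) x‖ ≤ R := ae_bdd_abs_condExp_of_ae_bdd_abs (ae_of_all _ hR)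
  have h1 : Integrable (Z * μ[Y | m]) μ := integrable_condExp.bdd_mul hZ (ae_of_all _ hR)
  have h2 : Integrable (μ[Z | m] * Y) μ :=
    hY.bdd_mul integrable_condExp.aestronglyMeasurable hb
  have e1 := condExp_mul_of_stronglyMeasurable_right (stronglyMeasurable_condExp (f := Y)) h1 hZi
  have e2 := condExp_mul_of_stronglyMeasurable_left (stronglyMeasurable_condExp (f := Z)) h2 hY
  have i1 := integral_condExp (μ := μ) (f := Z * μ[Y | m]) hm
  have i2 := integral_condExp (μ := μ) (f := μ[Z | m] * Y) hm
  calc ∫ x, Z x * (μ[Y | m]) x ∂μ = ∫ x, (μ[Z * μ[Y | m] | m]) x ∂μ := i1.symm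
    _ = ∫ x, (μ[μ[Z | m] * Y | m]) x ∂μ := integral_congr_ae (e1.trans e2.symm)
    _ = _ := i2

/-- If `μ[Z | G] = 0`, then `Z` is orthogonal to `G`-measurable functions. -/
theorem integral_mul_eq_zero_of_condExp_eq_zero [IsFiniteMeasure μ]
    (hG : G ≤ m0) {W Z : Ω → ℝ} (hW : StronglyMeasurable[G] W) (hZ : Integrable Z μ)
    (hWZ : Integrable (W * Z) μ) (h0 : μ[Z | G] =ᵐ[μ] 0) : ∫ x, W x * Z x ∂μ = 0 := by
  have e := condExp_mul_of_stronglyMeasurable_left hW hWZ hZ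
  have i := integral_condExp (μ := μ) (f := W * Z) hG
  calc ∫ x, W x * Z x ∂μ = ∫ x, (μ[W * Z | G]) x ∂μ := i.symm
    _ = ∫ x, (0 : ℝ) ∂μ := integral_congr_ae <| by
        filter_upwards [e, h0] with x h1 h2
        simp [h1, h2]
    _ = 0 := by simp

/-- Conditioning `m2`-measurable functions on `m` or on `m'` gives the same result. When
`m' ≤ m` this is conditional independence of `m` and `m2` given `m'`. -/
def CondExpAgree (μ : Measure Ω) (m m' m2 : MeasurableSpace Ω) : Prop :=
  ∀ Y : Ω → ℝ, StronglyMeasurable[m2] Y → Integrable Y μ → μ[Y | m] =ᵐ[μ] μ[Y | m']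

theorem CondExpAgree.mono (h : CondExpAgree μ m m' m2)
    (h32 : m3 ≤ m2) : CondExpAgree μ m m' m3 :=
  fun Y hY hYi => h Y (hY.mono h32) hYi

theorem abs_indicator_one_le (A : Set Ω) (x : Ω) :
    |A.indicator (fun _ => (1 : ℝ)) x| ≤ (1 : ℝ≥0) := by
  by_cases hx : x ∈ A <;> simp [hx]

theorem integrable_indicator_one [IsFiniteMeasure μ] {A : Set Ω} (hA : MeasurableSet A) :
    Integrable (A.indicator (fun _ => (1 : ℝ))) μ :=
  (integrable_const (1 : ℝ)).indicator hA

theorem integral_indicator_one_mul {A : Set Ω} (hA : MeasurableSet A) (Y : Ω → ℝ) :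
    ∫ x, A.indicator (fun _ => (1 : ℝ)) x * Y x ∂μ = ∫ x in A, Y x ∂μ := by
  rw [← integral_indicator hA]
  congr 1 with x
  by_cases hx : x ∈ A <;> simp [hx]

theorem setIntegral_indicator_one {A B : Set Ω} (hB : MeasurableSet B) :
    ∫ x in A, B.indicator (fun _ => (1 : ℝ)) x ∂μ = μ.real (B ∩ A) := by
  rw [integral_indicator hB, integral_const, smul_eq_mul, mul_one, measureReal_restrict_apply_univ,
    measureReal_restrict_apply hB]

theorem condExpAgree_of_isPiSystem [IsFiniteMeasure μ]
    (hm' : m' ≤ m) (hm : m ≤ m0) (hm2 : m2 ≤ m0) {C : Set (Set Ω)} (hC : IsPiSystem C)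
    (hgen : m2 = MeasurableSpace.generateFrom C)
    (h : ∀ B ∈ C, μ[B.indicator (fun _ => (1 : ℝ)) | m] =ᵐ[μ]
      μ[B.indicator (fun _ => (1 : ℝ)) | m']) :
    CondExpAgree μ m m' m2 := by
  intro Y hY hYi
  symm
  refine ae_eq_condExp_of_forall_setIntegral_eq hm hYi
    (fun s _ _ => integrable_condExp.integrableOn) ?_
    (stronglyMeasurable_condExp.mono hm').aestronglyMeasurable
  intro A hA _
  have hA0 := hm A hA
  set a : Ω → ℝ := μ[A.indicator (fun _ => (1 : ℝ)) | m'] with ha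
  have ha0 : 0 ≤ᵐ[μ] a :=
    condExp_nonneg (ae_of_all _ fun x => Set.indicator_nonneg (fun _ _ => zero_le_one) x)
  have haI : Integrable a μ := integrable_condExp
  have haM : Measurable a := (stronglyMeasurable_condExp.mono (hm'.trans hm)).measurable
  have hself : ∀ Z : Ω → ℝ, Integrable Z μ →
      ∫ x in A, (μ[Z | m']) x ∂μ = ∫ x, a x * Z x ∂μ := by
    intro Z hZ
    rw [← integral_indicator_one_mul hA0]
    exact integral_mul_condExp_comm (hm'.trans hm) (integrable_indicator_one hA0).1
      (abs_indicator_one_le A) hZ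
  have hdens : ∀ Z : Ω → ℝ, ∫ x, Z x ∂(μ.withDensity fun x => ENNReal.ofReal (a x)) =
      ∫ x, a x * Z x ∂μ := by
    intro Z
    rw [integral_withDensity_eq_integral_toReal_smul haM.ennreal_ofReal (by simp)]
    refine integral_congr_ae ?_
    filter_upwards [ha0] with x hx
    rw [ENNReal.toReal_ofReal hx, smul_eq_mul]
  have : IsFiniteMeasure (μ.withDensity fun x => ENNReal.ofReal (a x)) :=
    isFiniteMeasure_withDensity_ofReal haI.2
  have hreal : ∀ B, MeasurableSet B → μ[B.indicator (fun _ => (1 : ℝ)) | m] =ᵐ[μ]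
      μ[B.indicator (fun _ => (1 : ℝ)) | m'] →
      (μ.restrict A) B = (μ.withDensity fun x => ENNReal.ofReal (a x)) B := by
    intro B hB hBe
    have e1 : (μ.restrict A).real B = ∫ x in A, (μ[B.indicator (fun _ => (1 : ℝ)) | m']) x ∂μ := by
      rw [← setIntegral_congr_ae hA0 (hBe.mono fun x hx _ => hx),
        setIntegral_condExp hm (integrable_indicator_one hB) hA, setIntegral_indicator_one hB,
        measureReal_restrict_apply hB]
    rw [hself _ (integrable_indicator_one hB), ← hdens, integral_indicator hB, integral_const,
      smul_eq_mul, mul_one, measureReal_restrict_apply_univ] at e1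
    exact (ENNReal.toReal_eq_toReal_iff' (measure_ne_top _ _) (measure_ne_top _ _)).1 e1
  have htrim : (μ.restrict A).trim hm2 =
      (μ.withDensity fun x => ENNReal.ofReal (a x)).trim hm2 := by
    refine ext_of_generate_finite C hgen hC ?_ ?_
    · intro B hB
      have hB2 : MeasurableSet[m2] B := hgen ▸ MeasurableSpace.measurableSet_generateFrom hB
      rw [trim_measurableSet_eq hm2 hB2, trim_measurableSet_eq hm2 hB2]
      exact hreal B (hm2 B hB2) (h B hB)
    · rw [trim_measurableSet_eq hm2 .univ, trim_measurableSet_eq hm2 .univ]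
      refine hreal _ .univ ?_
      simp only [Set.indicator_univ]
      rw [condExp_const hm, condExp_const (hm'.trans hm)]
  rw [hself Y hYi, ← hdens, integral_trim hm2 hY, ← htrim, ← integral_trim hm2 hY]

theorem CondExpAgree.symm [IsFiniteMeasure μ]
    (h : CondExpAgree μ m m' m2) (hm' : m' ≤ m2) (hm : m ≤ m0) (hm2 : m2 ≤ m0) :
    CondExpAgree μ m2 m' m := by
  intro Y hY hYi
  symm
  refine ae_eq_condExp_of_forall_setIntegral_eq hm2 hYi
    (fun s _ _ => integrable_condExp.integrableOn) ?_
    (stronglyMeasurable_condExp.mono hm').aestronglyMeasurable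
  intro B hB _
  have hB0 := hm2 B hB
  have hBi := integrable_indicator_one (μ := μ) hB0
  have hc := h _ ((stronglyMeasurable_const (b := (1 : ℝ))).indicator hB) hBi
  have e1 := integral_mul_condExp_comm (hm'.trans hm2) hBi.1 (abs_indicator_one_le B) hYi
  have e2 := integral_mul_condExp_comm hm hBi.1 (abs_indicator_one_le B) hYi
  rw [integral_indicator_one_mul hB0] at e1 e2
  rw [e1, ← setIntegral_congr_ae hB0 ((condExp_of_stronglyMeasurable hm hY hYi).eventuallyEq.mono
    fun x hx _ => hx), e2]
  refine integral_congr_ae ?_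
  filter_upwards [hc] with x hx
  rw [hx]

theorem isPiSystem_inter (m1 m2 : MeasurableSpace Ω) :
    IsPiSystem {s : Set Ω | ∃ A B, MeasurableSet[m1] A ∧ MeasurableSet[m2] B ∧ A ∩ B = s} := by
  rintro _ ⟨A, B, hA, hB, rfl⟩ _ ⟨A', B', hA', hB', rfl⟩ -
  exact ⟨A ∩ A', B ∩ B', hA.inter hA', hB.inter hB', Set.inter_inter_inter_comm ..⟩

theorem sup_eq_generateFrom_inter (m1 m2 : MeasurableSpace Ω) :
    m1 ⊔ m2 = MeasurableSpace.generateFrom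
      {s : Set Ω | ∃ A B, MeasurableSet[m1] A ∧ MeasurableSet[m2] B ∧ A ∩ B = s} := by
  apply le_antisymm
  · refine sup_le (fun A hA => ?_) (fun B hB => ?_)
    · exact MeasurableSpace.measurableSet_generateFrom
        ⟨A, Set.univ, hA, .univ, Set.inter_univ A⟩
    · exact MeasurableSpace.measurableSet_generateFrom
        ⟨Set.univ, B, .univ, hB, Set.univ_inter B⟩
  · refine MeasurableSpace.generateFrom_le ?_
    rintro _ ⟨A, B, hA, hB, rfl⟩
    have h1 : m1 ≤ m1 ⊔ m2 := le_sup_left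
    have h2 : m2 ≤ m1 ⊔ m2 := le_sup_right
    exact (h1 A hA).inter (h2 B hB)

theorem condExp_indicator_inter [IsFiniteMeasure μ] {A B : Set Ω}
    (hA : MeasurableSet[m] A) (hB : MeasurableSet B) :
    μ[(A ∩ B).indicator (fun _ => (1 : ℝ)) | m] =ᵐ[μ]
      A.indicator (μ[B.indicator (fun _ => (1 : ℝ)) | m]) := by
  rw [← Set.indicator_indicator]
  exact condExp_indicator (integrable_indicator_one hB) hA

/-- If `μ[Y | m]` is a.e. equal to an `m'`-measurable function, then it equals `μ[Y | m']`. -/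
theorem condExp_eq_of_ae_eq_stronglyMeasurable [IsFiniteMeasure μ]
    (hm' : m' ≤ m) (hm : m ≤ m0) {Y Z : Ω → ℝ} (hZ : StronglyMeasurable[m'] Z)
    (h : μ[Y | m] =ᵐ[μ] Z) : μ[Y | m] =ᵐ[μ] μ[Y | m'] := by
  have hZi : Integrable Z μ := integrable_condExp.congr h
  have e := condExp_congr_ae (m := m') h
  rw [condExp_of_stronglyMeasurable (hm'.trans hm) hZ hZi] at e
  exact h.trans (e.symm.trans (condExp_condExp_of_le hm' hm))

theorem CondExpAgree.sup [IsFiniteMeasure μ]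
    (h : CondExpAgree μ m m' m2) (hm' : m' ≤ m) (hm : m ≤ m0) (hm2 : m2 ≤ m0) :
    CondExpAgree μ m m' (m' ⊔ m2) := by
  refine condExpAgree_of_isPiSystem hm' hm (sup_le (hm'.trans hm) hm2) (isPiSystem_inter m' m2)
    (sup_eq_generateFrom_inter m' m2) ?_
  rintro _ ⟨A, B, hA, hB, rfl⟩
  have hB0 := hm2 B hB
  refine condExp_eq_of_ae_eq_stronglyMeasurable hm' hm
    ((stronglyMeasurable_condExp (μ := μ) (f := B.indicator (fun _ => (1 : ℝ)))).indicator hA)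
    ((condExp_indicator_inter (hm' A hA) hB0).trans ?_)
  filter_upwards [h _ ((stronglyMeasurable_const (b := (1 : ℝ))).indicator hB)
    (integrable_indicator_one hB0)] with x hx
  simp only [Set.indicator, hx]

theorem CondExpAgree.tower [IsFiniteMeasure μ]
    (h : CondExpAgree μ F' s' G) (h1 : CondExpAgree μ F s s') (hsF : s ≤ F) (hFF' : F ≤ F')
    (hF' : F' ≤ m0) : CondExpAgree μ F s G := by
  intro Y hY hYi
  have e := h Y hY hYi
  refine (condExp_condExp_of_le hFF' hF').symm.trans ((condExp_congr_ae e).trans ?_)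
  refine (h1 _ stronglyMeasurable_condExp integrable_condExp).trans ?_
  exact (condExp_congr_ae e.symm).trans (condExp_condExp_of_le (hsF.trans hFF') hF')

end ConditionalExpectation

section Markov

variable {Ω S : Type*} [MeasurableSpace S]

/-- The sigma-algebra generated by `ξ k`, `a ≤ k ≤ b`. -/
abbrev window (ξ : ℤ → Ω → S) (a b : ℤ) : MeasurableSpace Ω :=
  ⨆ k : ℤ, ⨆ _ : a ≤ k ∧ k ≤ b, MeasurableSpace.comap (ξ k) inferInstance

variable {ξ : ℤ → Ω → S}

theorem comap_le_past {k n : ℤ} (h : k ≤ n) :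
    MeasurableSpace.comap (ξ k) inferInstance ≤ past ξ n :=
  le_iSup₂_of_le k h le_rfl

theorem comap_le_window {k a b : ℤ} (h1 : a ≤ k) (h2 : k ≤ b) :
    MeasurableSpace.comap (ξ k) inferInstance ≤ window ξ a b :=
  le_iSup₂_of_le k ⟨h1, h2⟩ le_rfl

theorem window_le_past {a b n : ℤ} (h : b ≤ n) : window ξ a b ≤ past ξ n :=
  iSup₂_le fun _ hk => comap_le_past (hk.2.trans h)

theorem window_mono {a b a' b' : ℤ} (h1 : a' ≤ a) (h2 : b ≤ b') : window ξ a b ≤ window ξ a' b' :=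
  iSup₂_le fun _ hk => comap_le_window (h1.trans hk.1) (hk.2.trans h2)

theorem past_mono {a b : ℤ} (h : a ≤ b) : past ξ a ≤ past ξ b :=
  iSup₂_le fun _ hk => comap_le_past (hk.trans h)

theorem pairSigma_le_window {a b : ℤ} (h : a ≤ b) : pairSigma ξ a b ≤ window ξ a b :=
  sup_le (comap_le_window le_rfl h) (comap_le_window h le_rfl)

variable [MeasurableSpace Ω]

theorem past_le (hξ : ∀ n, Measurable (ξ n)) (n : ℤ) : past ξ n ≤ ‹MeasurableSpace Ω› :=
  iSup₂_le fun k _ => (hξ k).comap_le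

theorem window_le (hξ : ∀ n, Measurable (ξ n)) (a b : ℤ) : window ξ a b ≤ ‹MeasurableSpace Ω› :=
  iSup₂_le fun k _ => (hξ k).comap_le

theorem pairSigma_le (hξ : ∀ n, Measurable (ξ n)) (a b : ℤ) :
    pairSigma ξ a b ≤ ‹MeasurableSpace Ω› :=
  sup_le (hξ a).comap_le (hξ b).comap_le

variable {μ : Measure Ω} [IsProbabilityMeasure μ]

theorem IsStationaryMarkovChain.condExpAgree_succ (hξ : IsStationaryMarkovChain μ ξ) (n : ℤ) :
    CondExpAgree μ (past ξ n) (MeasurableSpace.comap (ξ n) inferInstance)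
      (MeasurableSpace.comap (ξ (n + 1)) inferInstance) := by
  refine condExpAgree_of_isPiSystem (comap_le_past le_rfl) (past_le hξ.measurable n)
    (hξ.measurable _).comap_le
    (@MeasurableSpace.isPiSystem_measurableSet _ (MeasurableSpace.comap (ξ (n + 1)) inferInstance))
    (@MeasurableSpace.generateFrom_measurableSet _ (MeasurableSpace.comap _ _)).symm ?_
  rintro _ ⟨A, hA, rfl⟩
  exact hξ.markov n A hA

theorem IsStationaryMarkovChain.condExpAgree_past_window (hξ : IsStationaryMarkovChain μ ξ)
    (r : ℕ) (n : ℤ) :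
    CondExpAgree μ (past ξ n) (MeasurableSpace.comap (ξ n) inferInstance)
      (window ξ n (n + r)) := by
  induction r generalizing n with
  | zero =>
    intro Y hY hYi
    have hw : window ξ n (n + (0 : ℕ)) ≤ MeasurableSpace.comap (ξ n) inferInstance :=
      iSup₂_le fun k hk => by
        obtain rfl : k = n := by have := hk.1; have := hk.2; push_cast at *; omega
        exact le_rfl
    have hY' := hY.mono hw
    rw [condExp_of_stronglyMeasurable (hξ.measurable n).comap_le hY' hYi,
      condExp_of_stronglyMeasurable (past_le hξ.measurable n)
        (hY'.mono (comap_le_past le_rfl)) hYi]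
  | succ r ih =>
    have h1 := (ih (n + 1)).tower (hξ.condExpAgree_succ n) (comap_le_past le_rfl)
      (past_mono (by omega)) (past_le hξ.measurable _)
    refine (h1.sup (comap_le_past le_rfl) (past_le hξ.measurable _)
      (window_le hξ.measurable _ _)).mono (iSup₂_le fun k hk => ?_)
    rcases hk.1.eq_or_lt with rfl | hlt
    · exact le_sup_left
    · refine le_sup_of_le_right (comap_le_window (by omega) ?_)
      have := hk.2
      push_cast at *
      omega

/-- Two-sided Markov property. -/
theorem IsStationaryMarkovChain.condExpAgree_two_sided (hξ : IsStationaryMarkovChain μ ξ)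
    {a b c : ℤ} (hab : a ≤ b) (hbc : b ≤ c) :
    CondExpAgree μ (past ξ a ⊔ window ξ b c) (pairSigma ξ a b) (window ξ a b) := by
  have hM := hξ.measurable
  obtain ⟨r, rfl⟩ : ∃ r : ℕ, c = b + r := ⟨(c - b).toNat, by omega⟩
  obtain ⟨q, hq⟩ : ∃ q : ℕ, b = a + q := ⟨(b - a).toNat, by omega⟩
  have hpw : pairSigma ξ a b ≤ window ξ a b := pairSigma_le_window hab
  refine CondExpAgree.symm ?_ (sup_le ((comap_le_past le_rfl).trans le_sup_left)
    ((comap_le_window le_rfl hbc).trans le_sup_right)) (window_le hM a b)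
    (sup_le (past_le hM _) (window_le hM _ _))
  refine condExpAgree_of_isPiSystem hpw (window_le hM _ _)
    (sup_le (past_le hM _) (window_le hM _ _)) (isPiSystem_inter _ _)
    (sup_eq_generateFrom_inter _ _) ?_
  rintro _ ⟨A, B, hA, hB, rfl⟩
  have hA0 := past_le hM a A hA
  have hB0 := window_le hM _ _ B hB
  set one : Ω → ℝ := fun _ => 1
  set β : Ω → ℝ := μ[B.indicator one | MeasurableSpace.comap (ξ b) inferInstance] with hβ
  set α : Ω → ℝ := μ[A.indicator one | MeasurableSpace.comap (ξ a) inferInstance] with hα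
  have hβm : StronglyMeasurable[MeasurableSpace.comap (ξ b) inferInstance] β :=
    stronglyMeasurable_condExp
  have hαm : StronglyMeasurable[MeasurableSpace.comap (ξ a) inferInstance] α :=
    stronglyMeasurable_condExp
  have hAB : μ[(A ∩ B).indicator one | past ξ b] =ᵐ[μ] A.indicator one * β := by
    refine (condExp_indicator_inter (past_mono hab A hA) hB0).trans ?_
    filter_upwards [hξ.condExpAgree_past_window r b _
      ((stronglyMeasurable_const (b := (1 : ℝ))).indicator hB)
      (integrable_indicator_one hB0)] with x hx
    by_cases hxA : x ∈ A
    · simp [hxA, one, hx, hβ]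
    · simp [hxA]
  have hαeq : μ[A.indicator one | window ξ a b] =ᵐ[μ] α := by
    have h := (hξ.condExpAgree_past_window q a).symm (comap_le_window le_rfl (by omega))
      (past_le hM _) (window_le hM _ _)
    rw [← hq] at h
    exact h _ ((stronglyMeasurable_const (b := (1 : ℝ))).indicator hA)
      (integrable_indicator_one hA0)
  have hAβ : Integrable (A.indicator one * β) μ :=
    integrable_condExp.bdd_mul (integrable_indicator_one hA0).1
      (ae_of_all _ (abs_indicator_one_le A))
  have hwin : μ[(A ∩ B).indicator one | window ξ a b] =ᵐ[μ] α * β := by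
    refine (condExp_condExp_of_le (window_le_past le_rfl) (past_le hM b)).symm.trans ?_
    refine (condExp_congr_ae hAB).trans ?_
    refine (condExp_mul_of_stronglyMeasurable_right (hβm.mono (comap_le_window hab le_rfl)) hAβ
      (integrable_indicator_one hA0)).trans ?_
    filter_upwards [hαeq] with x hx
    simp [hx]
  exact condExp_eq_of_ae_eq_stronglyMeasurable hpw (window_le hM _ _)
    ((hαm.mono le_sup_left).mul (hβm.mono le_sup_right)) hwin

end Markov

section MeanErgodic

variable {Ω : Type*} [MeasurableSpace Ω] {μ : Measure Ω} {T : Ω → Ω}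

theorem integral_comp_measurePreserving {E : Type*} [NormedAddCommGroup E] [NormedSpace ℝ E]
    (hT : MeasurePreserving T μ μ) {h : Ω → E} (hh : AEStronglyMeasurable h μ) :
    ∫ x, h (T x) ∂μ = ∫ x, h x ∂μ := by
  have := integral_map hT.measurable.aemeasurable (f := h) (hT.map_eq.symm ▸ hh)
  rw [hT.map_eq] at this
  exact this.symm

theorem integrable_sum_comp_iterate (hT : MeasurePreserving T μ μ) {V : Ω → ℝ}
    (hV : Integrable V μ) (N : ℕ) :
    Integrable (fun x => (N : ℝ)⁻¹ * ∑ k ∈ Finset.range N, V (T^[k] x)) μ :=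
  (integrable_finsetSum _ fun k _ =>
    (hT.iterate k).integrable_comp_of_integrable hV).const_mul _

theorem integral_ergodicAverage (hT : MeasurePreserving T μ μ) {V : Ω → ℝ}
    (hV : Integrable V μ) {N : ℕ} (hN : N ≠ 0) :
    ∫ x, (N : ℝ)⁻¹ * ∑ k ∈ Finset.range N, V (T^[k] x) ∂μ = ∫ x, V x ∂μ := by
  have hi : ∀ k ∈ Finset.range N, Integrable (fun x => V (T^[k] x)) μ := fun k _ =>
    (hT.iterate k).integrable_comp_of_integrable hV
  rw [integral_const_mul, integral_finsetSum _ hi]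
  rw [Finset.sum_congr rfl fun k _ => integral_comp_measurePreserving (hT.iterate k) hV.1]
  simp only [Finset.sum_const, Finset.card_range, nsmul_eq_mul]
  field_simp

theorem integral_abs_ergodicAverage_le (hT : MeasurePreserving T μ μ) {V : Ω → ℝ}
    (hV : Integrable V μ) (N : ℕ) :
    ∫ x, |(N : ℝ)⁻¹ * ∑ k ∈ Finset.range N, V (T^[k] x)| ∂μ ≤ ∫ x, |V x| ∂μ := by
  rcases eq_or_ne N 0 with rfl | hN
  · simpa using integral_nonneg fun x => abs_nonneg (V x)
  rw [← integral_ergodicAverage hT hV.abs hN]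
  refine integral_mono (integrable_sum_comp_iterate hT hV N).abs
    (integrable_sum_comp_iterate hT hV.abs N) fun x => ?_
  simp only [abs_mul, abs_inv, Nat.abs_cast]
  gcongr
  exact Finset.abs_sum_le_sum_abs _ _

variable [IsProbabilityMeasure μ]

theorem integral_abs_le_sqrt {g : Ω → ℝ} (hg : MemLp g 2 μ) :
    ∫ x, |g x| ∂μ ≤ √(∫ x, g x ^ 2 ∂μ) := by
  refine Real.le_sqrt_of_sq_le ?_
  have h := variance_nonneg |g| μ
  rw [variance_eq_sub hg.abs] at h
  simpa [sq_abs] using h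

theorem tendsto_ergodicAverage_of_memLp_two (hT : Ergodic T μ) {V : Ω → ℝ} (hV : MemLp V 2 μ) :
    Tendsto (fun N : ℕ => ∫ x, |(N : ℝ)⁻¹ * ∑ k ∈ Finset.range N, V (T^[k] x) - ∫ y, V y ∂μ| ∂μ)
      atTop (𝓝 0) := by
  have hTm := hT.toMeasurePreserving
  have hVi : Integrable V μ := hV.integrable one_le_two
  obtain ⟨U, hU1, hU⟩ : ∃ U : Lp ℝ 2 μ →L[ℝ] Lp ℝ 2 μ, ‖U‖ ≤ 1 ∧
      ∀ f : Lp ℝ 2 μ, (U f : Ω → ℝ) =ᵐ[μ] f ∘ T :=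
    ⟨(Lp.compMeasurePreservingₗᵢ ℝ T hTm).toContinuousLinearMap,
      LinearIsometry.norm_toContinuousLinearMap_le _,
      fun f => Lp.coeFn_compMeasurePreserving f hTm⟩
  set v : Lp ℝ 2 μ := hV.toLp V with hv
  obtain ⟨w, hwU, hlim⟩ : ∃ w : Lp ℝ 2 μ, U w = w ∧
      Tendsto (fun N => birkhoffAverage ℝ U _root_.id N v) atTop (𝓝 w) :=
    ⟨_, LinearMap.mem_eqLocus.1 (Submodule.coe_mem _),
      U.tendsto_birkhoffAverage_orthogonalProjection hU1 v⟩
  obtain ⟨c, hc⟩ : ∃ c, w =ᵐ[μ] Function.const Ω c := by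
    refine hT.ae_eq_const_of_ae_eq_comp_ae (Lp.aestronglyMeasurable w) ?_
    have h1 := hU w
    rw [hwU] at h1
    exact h1.symm
  have hiter : ∀ k : ℕ, (U^[k] v : Ω → ℝ) =ᵐ[μ] fun x => V (T^[k] x) := by
    intro k
    induction k with
    | zero => exact hV.coeFn_toLp
    | succ k ih =>
      rw [Function.iterate_succ_apply']
      refine (hU (U^[k] v)).trans ?_
      filter_upwards [hTm.quasiMeasurePreserving.ae ih] with x hx
      simpa using hx
  have havg : ∀ N : ℕ, ((birkhoffAverage ℝ U _root_.id N v : Lp ℝ 2 μ) : Ω → ℝ) =ᵐ[μ]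
      fun x => (N : ℝ)⁻¹ * ∑ k ∈ Finset.range N, V (T^[k] x) := by
    intro N
    refine (Lp.coeFn_smul _ _).trans ?_
    have h2 := Lp.coeFn_fun_finsetSum (Finset.range N) fun k => U^[k] v
    filter_upwards [h2, (ae_all_iff.2 hiter)] with x h2 h3
    simp only [birkhoffSum, _root_.id, Pi.smul_apply, smul_eq_mul] at h2 ⊢
    rw [h2]
    simp [h3]
  have hle : ∀ N : ℕ, ∫ x, |(N : ℝ)⁻¹ * ∑ k ∈ Finset.range N, V (T^[k] x) - c| ∂μ ≤
      ‖birkhoffAverage ℝ U _root_.id N v - w‖ := by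
    intro N
    set g := birkhoffAverage ℝ U _root_.id N v - w
    have hg : (g : Ω → ℝ) =ᵐ[μ]
        fun x => (N : ℝ)⁻¹ * ∑ k ∈ Finset.range N, V (T^[k] x) - c := by
      filter_upwards [Lp.coeFn_sub (birkhoffAverage ℝ U _root_.id N v) w, havg N, hc]
        with x h1 h2 h3
      rw [h1, Pi.sub_apply, h2, h3, Function.const_apply]
    have h7 : ∫ x, |(N : ℝ)⁻¹ * ∑ k ∈ Finset.range N, V (T^[k] x) - c| ∂μ = ∫ x, |g x| ∂μ :=
      integral_congr_ae (by filter_upwards [hg] with x hx; rw [hx])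
    have h4 := lpNorm_one_eq_integral_norm (Lp.aestronglyMeasurable g)
    simp only [Real.norm_eq_abs] at h4
    rw [h7, ← h4, ← toReal_eLpNorm (Lp.aestronglyMeasurable g), Lp.norm_def]
    exact ENNReal.toReal_mono (Lp.eLpNorm_ne_top g)
      (eLpNorm_le_eLpNorm_of_exponent_le one_le_two (Lp.aestronglyMeasurable g))
  have hlim0 : Tendsto (fun N => ‖birkhoffAverage ℝ U _root_.id N v - w‖) atTop (𝓝 0) :=
    tendsto_iff_norm_sub_tendsto_zero.1 hlim
  have hcV : ∫ y, V y ∂μ = c := by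
    have h5 : |∫ y, V y ∂μ - c| ≤ 0 := by
      refine ge_of_tendsto hlim0 ?_
      filter_upwards [eventually_ne_atTop 0] with N hN
      refine le_trans ?_ (hle N)
      have h6 : ∫ y, V y ∂μ - c =
          ∫ x, ((N : ℝ)⁻¹ * ∑ k ∈ Finset.range N, V (T^[k] x) - c) ∂μ := by
        rw [integral_sub (integrable_sum_comp_iterate hTm hVi N) (integrable_const c),
          integral_ergodicAverage hTm hVi hN]
        simp
      rw [h6]
      exact abs_integral_le_integral_abs
    exact sub_eq_zero.1 (abs_nonpos_iff.1 h5)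
  rw [hcV]
  exact squeeze_zero (fun N => integral_nonneg fun x => abs_nonneg _) hle hlim0

/-- The mean ergodic theorem in `L¹`. -/
theorem tendsto_ergodicAverage (hT : Ergodic T μ) {V : Ω → ℝ} (hV : Integrable V μ) :
    Tendsto (fun N : ℕ => ∫ x, |(N : ℝ)⁻¹ * ∑ k ∈ Finset.range N, V (T^[k] x) - ∫ y, V y ∂μ| ∂μ)
      atTop (𝓝 0) := by
  have hTm := hT.toMeasurePreserving
  rw [Metric.tendsto_atTop]
  intro ε hε
  obtain ⟨g, hg, hg1⟩ := (memLp_one_iff_integrable.2 hV).exists_simpleFunc_eLpNorm_sub_lt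
    ENNReal.one_ne_top (ε := ENNReal.ofReal (ε / 3)) (by simp [hε])
  have hgi : Integrable g μ := memLp_one_iff_integrable.1 hg1
  have hg2 : MemLp g 2 μ := g.memLp_of_isFiniteMeasure 2 μ
  have hd : ∫ x, |V x - g x| ∂μ < ε / 3 := by
    have h := lpNorm_one_eq_integral_norm (hV.sub hgi).1
    simp only [Real.norm_eq_abs, Pi.sub_apply] at h
    rw [← h, ← toReal_eLpNorm (hV.sub hgi).1]
    exact (ENNReal.lt_ofReal_iff_toReal_lt hg.ne_top).1 hg
  obtain ⟨N0, hN0⟩ := Metric.tendsto_atTop.1 (tendsto_ergodicAverage_of_memLp_two hT hg2)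
    (ε / 3) (by positivity)
  refine ⟨N0, fun N hN => ?_⟩
  have h1 := hN0 N hN
  rw [Real.dist_eq, sub_zero, abs_of_nonneg (integral_nonneg fun x => abs_nonneg _)] at h1 ⊢
  have hVg : Integrable (fun x => V x - g x) μ := hV.sub hgi
  have h2 : |∫ y, g y ∂μ - ∫ y, V y ∂μ| ≤ ∫ x, |V x - g x| ∂μ := by
    rw [abs_sub_comm, ← integral_sub hV hgi]
    exact abs_integral_le_integral_abs
  have h3 := integral_abs_ergodicAverage_le hTm hVg N
  have i1 := (integrable_sum_comp_iterate hTm hVg N).abs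
  have i2 := ((integrable_sum_comp_iterate hTm hgi N).sub (integrable_const (∫ y, g y ∂μ))).abs
  have i3 := ((integrable_sum_comp_iterate hTm hV N).sub (integrable_const (∫ y, V y ∂μ))).abs
  have h4 : ∫ x, |(N : ℝ)⁻¹ * ∑ k ∈ Finset.range N, V (T^[k] x) - ∫ y, V y ∂μ| ∂μ ≤
      ∫ x, ((|(N : ℝ)⁻¹ * ∑ k ∈ Finset.range N, (V (T^[k] x) - g (T^[k] x))| +
        |(N : ℝ)⁻¹ * ∑ k ∈ Finset.range N, g (T^[k] x) - ∫ y, g y ∂μ|) +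
        |∫ y, g y ∂μ - ∫ y, V y ∂μ|) ∂μ := by
    refine integral_mono i3 ((i1.add i2).add (integrable_const _)) fun x => ?_
    refine le_trans (le_of_eq ?_) (abs_add_three _ _ _)
    congr 1
    rw [Finset.sum_sub_distrib]
    ring
  rw [integral_add (by exact i1.add i2) (integrable_const _),
    integral_add i1 (by exact i2)] at h4
  simp only [integral_const, probReal_univ, one_smul] at h4
  linarith

end MeanErgodic

section Taylor

/-- The second order Taylor remainder of `y ↦ exp (I * y)`. -/
noncomputable def expIRemainder (y : ℝ) : ℂ :=
  Complex.exp (Complex.I * y) - 1 - Complex.I * y + (y : ℂ) ^ 2 / 2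

theorem norm_expIRemainder_le_cube (y : ℝ) :
    ‖expIRemainder y‖ ≤ |y| ^ 3 * Real.exp |y| := by
  have h := Complex.norm_exp_sub_sum_le_norm_mul_exp (Complex.I * y) 3
  have hn : ‖Complex.I * (y : ℂ)‖ = |y| := by simp
  rw [hn] at h
  refine le_trans (le_of_eq ?_) h
  congr 1
  simp only [expIRemainder, Finset.sum_range_succ, Finset.sum_range_zero, mul_pow, Complex.I_sq,
    Nat.factorial]
  push_cast
  ring

theorem norm_expIRemainder_le_sq (y : ℝ) : ‖expIRemainder y‖ ≤ 4 * y ^ 2 := by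
  rcases le_total |y| 1 with h | h
  · refine (norm_expIRemainder_le_cube y).trans ?_
    have h1 : Real.exp |y| ≤ 4 :=
      (Real.exp_le_exp.2 h).trans (by linarith [Real.exp_one_lt_d9])
    calc |y| ^ 3 * Real.exp |y| = y ^ 2 * (|y| * Real.exp |y|) := by rw [← sq_abs y]; ring
      _ ≤ y ^ 2 * (1 * 4) := by gcongr
      _ = 4 * y ^ 2 := by ring
  · have h1 : ‖Complex.exp (Complex.I * y)‖ = 1 := by
      rw [mul_comm]; exact Complex.norm_exp_ofReal_mul_I y
    have h2 : ‖expIRemainder y‖ ≤ 1 + 1 + |y| + y ^ 2 / 2 := by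
      refine (norm_add_le _ _).trans (add_le_add ((norm_sub_le _ _).trans (add_le_add
        ((norm_sub_le _ _).trans (by simp [h1])) (by simp))) (by simp))
    have h3 : |y| ≤ y ^ 2 := by rw [← sq_abs]; nlinarith
    nlinarith

theorem abs_exp_neg_sub_one_add_le_sq {v : ℝ} (hv : 0 ≤ v) :
    |Real.exp (-v) - 1 + v| ≤ v ^ 2 := by
  rcases le_total v 1 with h | h
  · have := Real.abs_exp_sub_one_sub_id_le (x := -v) (by rwa [abs_neg, abs_of_nonneg hv])
    simpa using this
  · have h1 := Real.add_one_le_exp (-v)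
    have h2 : Real.exp (-v) ≤ 1 := Real.exp_le_one_iff.2 (by linarith)
    rw [abs_of_nonneg (by linarith)]
    nlinarith

theorem abs_exp_neg_sub_one_add_le {v : ℝ} (hv : 0 ≤ v) : |Real.exp (-v) - 1 + v| ≤ v := by
  have h1 := Real.add_one_le_exp (-v)
  have h2 : Real.exp (-v) ≤ 1 := Real.exp_le_one_iff.2 (by linarith)
  rw [abs_of_nonneg (by linarith)]
  linarith

theorem abs_exp_neg_sub_exp_neg_le {a b : ℝ} (ha : 0 ≤ a) (hb : 0 ≤ b) :
    |Real.exp (-a) - Real.exp (-b)| ≤ |a - b| := by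
  wlog h : a ≤ b generalizing a b
  · rw [abs_sub_comm, abs_sub_comm a]
    exact this hb ha (le_of_not_ge h)
  have h1 : Real.exp (-b) ≤ Real.exp (-a) := Real.exp_le_exp.2 (by linarith)
  rw [abs_of_nonneg (by linarith), abs_of_nonpos (by linarith)]
  have h2 := Real.add_one_le_exp (-(b - a))
  have h3 : Real.exp (-b) = Real.exp (-a) * Real.exp (-(b - a)) := by
    rw [← Real.exp_add]; ring_nf
  have h4 : Real.exp (-a) ≤ 1 := Real.exp_le_one_iff.2 (by linarith)
  have h5 := Real.exp_pos (-a)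
  rw [h3]
  nlinarith

theorem prod_range_sub_prod_range {R : Type*} [CommRing R] (u c : ℕ → R) (N : ℕ) :
    ∏ k ∈ Finset.range N, u k - ∏ k ∈ Finset.range N, c k =
      ∑ k ∈ Finset.range N, ((∏ j ∈ Finset.range k, u j) * ∏ j ∈ Finset.Ico (k + 1) N, c j) *
        (u k - c k) := by
  induction N with
  | zero => simp
  | succ N ih =>
    rw [Finset.sum_range_succ, Finset.prod_range_succ, Finset.prod_range_succ, Finset.Ico_self,
      Finset.prod_empty]
    have : ∀ k ∈ Finset.range N,
        ((∏ j ∈ Finset.range k, u j) * ∏ j ∈ Finset.Ico (k + 1) (N + 1), c j) * (u k - c k) =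
        ((∏ j ∈ Finset.range k, u j) * ∏ j ∈ Finset.Ico (k + 1) N, c j) * (u k - c k) * c N := by
      intro k hk
      rw [Finset.prod_Ico_succ_top (Finset.mem_range.1 hk)]
      ring
    rw [Finset.sum_congr rfl this, ← Finset.sum_mul, ← ih]
    ring

end Taylor

section CentralLimit

variable {Ω : Type*} {G : MeasurableSpace Ω} [m0 : MeasurableSpace Ω] {μ : Measure Ω}
  {T : Ω → Ω}

/-- The error of one replacement step. -/
noncomputable def stepError (D V : Ω → ℝ) (τ : ℝ) (x : Ω) : ℝ :=
  ‖expIRemainder (τ * D x)‖ + |Real.exp (-(τ ^ 2 * V x / 2)) - 1 + τ ^ 2 * V x / 2|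

theorem tendsto_mul_integral_stepError {D V : Ω → ℝ} (hD : MemLp D 2 μ) (hV : Integrable V μ)
    (hV0 : ∀ x, 0 ≤ V x) {N : ℕ → ℕ} {τ : ℕ → ℝ} {w : ℝ} (hN : Tendsto N atTop atTop)
    (hτ : Tendsto (fun n => N n * τ n ^ 2) atTop (𝓝 w)) :
    Tendsto (fun n => N n * ∫ x, stepError D V (τ n) x ∂μ) atTop (𝓝 0) := by
  have hτ2 : Tendsto (fun n => τ n ^ 2) atTop (𝓝 0) := by
    have h1 : Tendsto (fun n => (N n * τ n ^ 2) * (N n : ℝ)⁻¹) atTop (𝓝 (w * 0)) :=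
      hτ.mul (tendsto_inv_atTop_zero.comp (tendsto_natCast_atTop_atTop.comp hN))
    rw [mul_zero] at h1
    refine h1.congr' ?_
    filter_upwards [hN.eventually_ne_atTop 0] with n hn
    have : (N n : ℝ) ≠ 0 := by exact_mod_cast hn
    field_simp
  have hτ0 : Tendsto (fun n => |τ n|) atTop (𝓝 0) := by
    have := (Real.continuous_sqrt.tendsto 0).comp hτ2
    simpa [Function.comp_def, Real.sqrt_sq_eq_abs] using this
  simp_rw [← integral_const_mul]
  rw [show (0 : ℝ) = ∫ _ : Ω, (0 : ℝ) ∂μ by simp]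
  refine tendsto_integral_filter_of_dominated_convergence
    (fun x => (w + 1) * (4 * D x ^ 2 + V x / 2)) (Eventually.of_forall fun n => ?_) ?_
    (((hD.integrable_sq.const_mul 4).add (hV.div_const 2)).const_mul _) (ae_of_all _ fun x => ?_)
  · have := hD.aestronglyMeasurable.aemeasurable
    have := hV.aemeasurable
    unfold stepError expIRemainder
    exact AEMeasurable.aestronglyMeasurable (by fun_prop)
  · filter_upwards [hτ.eventually_le_const (lt_add_one w)] with n hn
    refine ae_of_all _ fun x => ?_
    have hs0 : 0 ≤ stepError D V (τ n) x := by unfold stepError; positivity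
    rw [Real.norm_of_nonneg (by positivity)]
    have hv := hV0 x
    have h1 := norm_expIRemainder_le_sq (τ n * D x)
    have h2 := abs_exp_neg_sub_one_add_le (v := τ n ^ 2 * V x / 2) (by positivity)
    calc (N n : ℝ) * stepError D V (τ n) x
        ≤ N n * (4 * (τ n * D x) ^ 2 + τ n ^ 2 * V x / 2) := by
          unfold stepError; gcongr
      _ = (N n * τ n ^ 2) * (4 * D x ^ 2 + V x / 2) := by ring
      _ ≤ _ := by gcongr
  · have hv := hV0 x
    have hlim : Tendsto (fun n => (N n * τ n ^ 2) * (|τ n| * (|D x| ^ 3 *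
        Real.exp (|τ n| * |D x|)) + τ n ^ 2 * (V x ^ 2 / 4))) atTop (𝓝 (w * (0 * (|D x| ^ 3 * Real.exp (0 * |D x|)) +
          0 * (V x ^ 2 / 4)))) :=
      hτ.mul ((hτ0.mul (((Real.continuous_exp.tendsto _).comp
        (hτ0.mul_const |D x|)).const_mul _)).add (hτ2.mul_const _))
    simp only [zero_mul, add_zero, mul_zero] at hlim
    refine squeeze_zero (fun n => ?_) (fun n => ?_) hlim
    · unfold stepError; positivity
    · have h1 := norm_expIRemainder_le_cube (τ n * D x)
      have h2 := abs_exp_neg_sub_one_add_le_sq (v := τ n ^ 2 * V x / 2) (by positivity)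
      calc (N n : ℝ) * stepError D V (τ n) x
          ≤ N n * (|τ n * D x| ^ 3 * Real.exp |τ n * D x| + (τ n ^ 2 * V x / 2) ^ 2) := by
            unfold stepError; gcongr
        _ = _ := by
          rw [abs_mul, ← sq_abs (τ n)]
          ring

variable [IsProbabilityMeasure μ]

theorem integral_complex_mul_eq_zero (hG : G ≤ m0) {W : Ω → ℂ} {Z : Ω → ℝ}
    (hW : StronglyMeasurable[G] W) (hWb : ∀ x, ‖W x‖ ≤ 1) (hZ : Integrable Z μ)
    (h0 : μ[Z | G] =ᵐ[μ] 0) : ∫ x, W x * (Z x : ℂ) ∂μ = 0 := by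
  have hWm := hW.mono hG
  have hi : Integrable (fun x => W x * (Z x : ℂ)) μ :=
    hZ.ofReal.bdd_mul hWm.aestronglyMeasurable (ae_of_all _ hWb)
  have hre : StronglyMeasurable[G] fun x => (W x).re :=
    Complex.continuous_re.comp_stronglyMeasurable hW
  have him : StronglyMeasurable[G] fun x => (W x).im :=
    Complex.continuous_im.comp_stronglyMeasurable hW
  have e1 := integral_mul_eq_zero_of_condExp_eq_zero hG hre hZ
    (hZ.bdd_mul (hre.mono hG).aestronglyMeasurable
      (ae_of_all _ fun x => (Complex.abs_re_le_norm _).trans (hWb x))) h0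
  have e2 := integral_mul_eq_zero_of_condExp_eq_zero hG him hZ
    (hZ.bdd_mul (him.mono hG).aestronglyMeasurable
      (ae_of_all _ fun x => (Complex.abs_im_le_norm _).trans (hWb x))) h0
  have e3 := integral_re_add_im (𝕜 := ℂ) hi
  rw [← e3]
  simp [e1, e2]

/-- One step of the Lindeberg replacement scheme. -/
theorem norm_integral_mul_sub_le (hG : G ≤ m0) {W : Ω → ℂ} {Z V : Ω → ℝ}
    (hW : StronglyMeasurable[G] W) (hWb : ∀ x, ‖W x‖ ≤ 1) (hZ : MemLp Z 2 μ)
    (hV : Integrable V μ) (hV0 : ∀ x, 0 ≤ V x) (h1 : μ[Z | G] =ᵐ[μ] 0)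
    (h2 : μ[fun x => Z x ^ 2 - V x | G] =ᵐ[μ] 0) (τ : ℝ) :
    ‖∫ x, W x * (Complex.exp (Complex.I * (τ * Z x : ℝ)) -
        (Real.exp (-(τ ^ 2 * V x / 2)) : ℂ)) ∂μ‖ ≤
      ∫ x, (‖expIRemainder (τ * Z x)‖ +
        |Real.exp (-(τ ^ 2 * V x / 2)) - 1 + τ ^ 2 * V x / 2|) ∂μ := by
  have hZi : Integrable Z μ := hZ.integrable one_le_two
  have hZV : Integrable (fun x => Z x ^ 2 - V x) μ := hZ.integrable_sq.sub hV
  have hWm := (hW.mono hG).aestronglyMeasurable (μ := μ)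
  set r : Ω → ℂ := fun x => expIRemainder (τ * Z x) -
    ((Real.exp (-(τ ^ 2 * V x / 2)) - 1 + τ ^ 2 * V x / 2 : ℝ) : ℂ) with hr
  have hdec : ∀ x, W x * (Complex.exp (Complex.I * (τ * Z x : ℝ)) -
      (Real.exp (-(τ ^ 2 * V x / 2)) : ℂ)) =
      (Complex.I * τ) * (W x * (Z x : ℂ)) - (τ ^ 2 / 2 : ℂ) * (W x * ((Z x ^ 2 - V x : ℝ) : ℂ)) +
        W x * r x := by
    intro x
    simp only [hr, expIRemainder]
    push_cast
    ring
  have i1 : Integrable (fun x => W x * (Z x : ℂ)) μ :=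
    hZi.ofReal.bdd_mul hWm (ae_of_all _ hWb)
  have i2 : Integrable (fun x => W x * ((Z x ^ 2 - V x : ℝ) : ℂ)) μ :=
    hZV.ofReal.bdd_mul hWm (ae_of_all _ hWb)
  have hZm : AEMeasurable Z μ := hZi.aemeasurable
  have hVm : AEMeasurable V μ := hV.aemeasurable
  have iq : Integrable (fun x => expIRemainder (τ * Z x)) μ := by
    refine Integrable.mono' (hZ.integrable_sq.const_mul (4 * τ ^ 2)) ?_ (ae_of_all _ fun x => ?_)
    · unfold expIRemainder
      exact AEMeasurable.aestronglyMeasurable (by fun_prop)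
    · refine (norm_expIRemainder_le_sq _).trans (le_of_eq (by ring))
  have ip : Integrable (fun x => Real.exp (-(τ ^ 2 * V x / 2)) - 1 + τ ^ 2 * V x / 2) μ := by
    refine Integrable.mono' (hV.const_mul (τ ^ 2 / 2)) ?_ (ae_of_all _ fun x => ?_)
    · exact AEMeasurable.aestronglyMeasurable (by fun_prop)
    · have h0 : 0 ≤ τ ^ 2 * V x / 2 := by have := hV0 x; positivity
      exact (abs_exp_neg_sub_one_add_le h0).trans (le_of_eq (by ring))
  have ir : Integrable r μ := iq.sub ip.ofReal
  have i3 : Integrable (fun x => W x * r x) μ := ir.bdd_mul hWm (ae_of_all _ hWb)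
  simp_rw [hdec]
  rw [integral_add (by exact (i1.const_mul _).sub (i2.const_mul _)) i3,
    integral_sub (i1.const_mul _) (i2.const_mul _), integral_const_mul, integral_const_mul,
    integral_complex_mul_eq_zero hG hW hWb hZi h1, integral_complex_mul_eq_zero hG hW hWb hZV h2]
  simp only [mul_zero, sub_zero, zero_add]
  refine (norm_integral_le_integral_norm _).trans ?_
  refine integral_mono i3.norm (iq.norm.add ip.abs) fun x => ?_
  rw [norm_mul]
  refine (mul_le_of_le_one_left (norm_nonneg _) (hWb x)).trans ?_
  refine (norm_sub_le _ _).trans (le_of_eq ?_)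
  rw [Complex.norm_real, Real.norm_eq_abs]

/-- A family of sigma-algebras `G k`, `k < N`, making the sequence `D ∘ T^[k]` amenable to
Lindeberg replacement: `D ∘ T^[k]` is centered with conditional variance `V ∘ T^[k]` given `G k`,
and `G k` contains the earlier terms and the later conditional variances. -/
structure LindebergScheme (μ : Measure Ω) (T : Ω → Ω) (D V : Ω → ℝ) (N : ℕ)
    (G : ℕ → MeasurableSpace Ω) : Prop where
  le : ∀ k, k < N → G k ≤ m0
  before : ∀ k j, j < k → k < N → StronglyMeasurable[G k] fun x => D (T^[j] x)
  after : ∀ k j, k < j → j < N → StronglyMeasurable[G k] fun x => V (T^[j] x)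
  centered : ∀ k, k < N → μ[fun x => D (T^[k] x) | G k] =ᵐ[μ] 0
  variance : ∀ k, k < N → μ[fun x => D (T^[k] x) ^ 2 - V (T^[k] x) | G k] =ᵐ[μ] 0

theorem LindebergScheme.norm_integral_sub_le {D V : Ω → ℝ} {N : ℕ} {G : ℕ → MeasurableSpace Ω}
    (h : LindebergScheme μ T D V N G) (hT : MeasurePreserving T μ μ) (hD : MemLp D 2 μ)
    (hV : Integrable V μ) (hV0 : ∀ x, 0 ≤ V x) (τ : ℝ) :
    ‖∫ x, Complex.exp (Complex.I * (τ * ∑ k ∈ Finset.range N, D (T^[k] x) : ℝ)) ∂μ -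
      ∫ x, (Real.exp (-(τ ^ 2 / 2 * ∑ k ∈ Finset.range N, V (T^[k] x))) : ℂ) ∂μ‖ ≤
      N * ∫ x, stepError D V τ x ∂μ := by
  set u : ℕ → Ω → ℂ := fun k x => Complex.exp (Complex.I * (τ * D (T^[k] x) : ℝ)) with hu
  set c : ℕ → Ω → ℂ := fun k x => (Real.exp (-(τ ^ 2 * V (T^[k] x) / 2)) : ℂ) with hc
  have hexpD : Measurable fun y : ℝ => Complex.exp (Complex.I * (τ * y : ℝ)) := by fun_prop
  have hexpV : Measurable fun y : ℝ => (Real.exp (-(τ ^ 2 * y / 2)) : ℂ) := by fun_prop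
  have hDk : ∀ k, MemLp (fun x => D (T^[k] x)) 2 μ := fun k =>
    hD.comp_measurePreserving (hT.iterate k)
  have hVk : ∀ k, Integrable (fun x => V (T^[k] x)) μ := fun k =>
    (hT.iterate k).integrable_comp_of_integrable hV
  have hunorm : ∀ k x, ‖u k x‖ ≤ 1 := fun k x => by
    simp only [hu]
    rw [mul_comm, Complex.norm_exp_ofReal_mul_I]
  have hcnorm : ∀ k x, ‖c k x‖ ≤ 1 := fun k x => by
    simp only [hc, Complex.norm_real, Real.norm_eq_abs, Real.abs_exp]
    refine Real.exp_le_one_iff.2 ?_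
    have := hV0 (T^[k] x)
    have : 0 ≤ τ ^ 2 * V (T^[k] x) / 2 := by positivity
    linarith
  have hum : ∀ k, AEStronglyMeasurable (u k) μ := fun k => by
    have := (hDk k).aestronglyMeasurable.aemeasurable
    exact (hexpD.comp_aemeasurable this).aestronglyMeasurable
  have hcm : ∀ k, AEStronglyMeasurable (c k) μ := fun k => by
    have := (hVk k).aemeasurable
    exact (hexpV.comp_aemeasurable this).aestronglyMeasurable
  have hprod : ∀ (v : ℕ → Ω → ℂ), (∀ k x, ‖v k x‖ ≤ 1) → ∀ (s : Finset ℕ) (x : Ω),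
      ‖∏ k ∈ s, v k x‖ ≤ 1 := fun v hv s x => by
    rw [norm_prod]
    exact Finset.prod_le_one (fun _ _ => norm_nonneg _) fun k _ => hv k x
  have e1 : ∀ x, Complex.exp (Complex.I * (τ * ∑ k ∈ Finset.range N, D (T^[k] x) : ℝ)) =
      ∏ k ∈ Finset.range N, u k x := fun x => by
    simp only [hu]
    rw [← Complex.exp_sum, Finset.mul_sum]
    push_cast
    rw [Finset.mul_sum]
  have e2 : ∀ x, (Real.exp (-(τ ^ 2 / 2 * ∑ k ∈ Finset.range N, V (T^[k] x))) : ℂ) =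
      ∏ k ∈ Finset.range N, c k x := fun x => by
    simp only [hc]
    rw [← Complex.ofReal_prod, ← Real.exp_sum, Finset.mul_sum, ← Finset.sum_neg_distrib]
    congr 2
    exact Finset.sum_congr rfl fun k _ => by ring
  simp_rw [e1, e2]
  have iu : Integrable (fun x => ∏ k ∈ Finset.range N, u k x) μ :=
    Integrable.of_bound (Finset.aestronglyMeasurable_fun_prod _ fun k _ => hum k) 1
      (ae_of_all _ (hprod u hunorm _))
  have ic : Integrable (fun x => ∏ k ∈ Finset.range N, c k x) μ :=
    Integrable.of_bound (Finset.aestronglyMeasurable_fun_prod _ fun k _ => hcm k) 1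
      (ae_of_all _ (hprod c hcnorm _))
  set W : ℕ → Ω → ℂ := fun k x =>
    (∏ j ∈ Finset.range k, u j x) * ∏ j ∈ Finset.Ico (k + 1) N, c j x with hW
  have hWnorm : ∀ k x, ‖W k x‖ ≤ 1 := fun k x => by
    simp only [hW, norm_mul]
    exact mul_le_one₀ (hprod u hunorm _ x) (norm_nonneg _) (hprod c hcnorm _ x)
  have hWm : ∀ k, k < N → StronglyMeasurable[G k] (W k) := by
    intro k hk
    refine StronglyMeasurable.mul ?_ ?_
    · refine Finset.stronglyMeasurable_fun_prod _ fun j hj => ?_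
      have := (h.before k j (Finset.mem_range.1 hj) hk).measurable
      exact (hexpD.comp this).stronglyMeasurable
    · refine Finset.stronglyMeasurable_fun_prod _ fun j hj => ?_
      have := (h.after k j (Nat.lt_of_succ_le (Finset.mem_Ico.1 hj).1)
        (Finset.mem_Ico.1 hj).2).measurable
      exact (hexpV.comp this).stronglyMeasurable
  have iW : ∀ k ∈ Finset.range N, Integrable (fun x => W k x * (u k x - c k x)) μ := by
    intro k hk
    have hk := Finset.mem_range.1 hk
    refine Integrable.of_bound (C := 2) (((hWm k hk).mono (h.le k hk)).aestronglyMeasurable.mul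
      ((hum k).sub (hcm k))) (ae_of_all _ fun x => ?_)
    rw [norm_mul]
    have h1 := norm_sub_le (u k x) (c k x)
    have h2 := hunorm k x
    have h3 := hcnorm k x
    have h4 := hWnorm k x
    calc ‖W k x‖ * ‖u k x - c k x‖ ≤ 1 * 2 := by gcongr; linarith
      _ = 2 := one_mul 2
  rw [← integral_sub iu ic, integral_congr_ae (ae_of_all _ fun x =>
    prod_range_sub_prod_range (fun k => u k x) (fun k => c k x) N), integral_finsetSum _ iW]
  refine (norm_sum_le _ _).trans ?_
  have hstep : ∀ k ∈ Finset.range N, ‖∫ x, W k x * (u k x - c k x) ∂μ‖ ≤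
      ∫ x, stepError D V τ x ∂μ := by
    intro k hk
    have hk := Finset.mem_range.1 hk
    refine (norm_integral_mul_sub_le (h.le k hk) (hWm k hk) (hWnorm k) (hDk k) (hVk k)
      (fun x => hV0 _) (h.centered k hk) (h.variance k hk) τ).trans (le_of_eq ?_)
    refine integral_comp_measurePreserving (hT.iterate k) (h := stepError D V τ) ?_
    have := hD.aestronglyMeasurable.aemeasurable
    have := hV.aemeasurable
    unfold stepError expIRemainder
    exact AEMeasurable.aestronglyMeasurable (by fun_prop)
  refine (Finset.sum_le_sum hstep).trans (le_of_eq ?_)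
  simp

theorem tendsto_integral_exp_ergodicSum (hT : Ergodic T μ) {V : Ω → ℝ} (hV : Integrable V μ)
    (hV0 : ∀ x, 0 ≤ V x) {N : ℕ → ℕ} {τ : ℕ → ℝ} {w : ℝ} (hN : Tendsto N atTop atTop)
    (hτ : Tendsto (fun n => N n * τ n ^ 2) atTop (𝓝 w)) :
    Tendsto (fun n => ∫ x, Real.exp (-(τ n ^ 2 / 2 * ∑ k ∈ Finset.range (N n), V (T^[k] x))) ∂μ)
      atTop (𝓝 (Real.exp (-(w / 2 * ∫ x, V x ∂μ)))) := by
  have hTm := hT.toMeasurePreserving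
  set v := ∫ x, V x ∂μ with hv
  have hv0 : 0 ≤ v := integral_nonneg hV0
  have hw0 : 0 ≤ w := ge_of_tendsto' hτ fun n => by positivity
  rw [tendsto_iff_norm_sub_tendsto_zero]
  have hlim : Tendsto (fun n => (N n * τ n ^ 2) / 2 *
      (∫ x, |(N n : ℝ)⁻¹ * ∑ k ∈ Finset.range (N n), V (T^[k] x) - v| ∂μ) +
      |(N n * τ n ^ 2) / 2 - w / 2| * v) atTop (𝓝 (w / 2 * 0 + |w / 2 - w / 2| * v)) :=
    ((hτ.div_const 2).mul ((tendsto_ergodicAverage hT hV).comp hN)).add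
      ((((hτ.div_const 2).sub_const _).abs).mul_const v)
  simp only [mul_zero, sub_self, abs_zero, zero_mul, add_zero] at hlim
  refine squeeze_zero' (Eventually.of_forall fun n => norm_nonneg _) ?_ hlim
  filter_upwards [hN.eventually_ne_atTop 0] with n hn
  have hn' : (N n : ℝ) ≠ 0 := by exact_mod_cast hn
  have hS0 : ∀ x, 0 ≤ ∑ k ∈ Finset.range (N n), V (T^[k] x) := fun x =>
    Finset.sum_nonneg fun k _ => hV0 _
  have hSi : Integrable (fun x => ∑ k ∈ Finset.range (N n), V (T^[k] x)) μ :=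
    integrable_finsetSum _ fun k _ => (hTm.iterate k).integrable_comp_of_integrable hV
  have hSm := hSi.aemeasurable
  have i1 : Integrable
      (fun x => Real.exp (-(τ n ^ 2 / 2 * ∑ k ∈ Finset.range (N n), V (T^[k] x)))) μ := by
    refine Integrable.of_bound (C := 1) (AEMeasurable.aestronglyMeasurable (by fun_prop))
      (ae_of_all _ fun x => ?_)
    rw [Real.norm_eq_abs, Real.abs_exp]
    refine Real.exp_le_one_iff.2 (neg_nonpos.2 ?_)
    have := hS0 x
    positivity
  have i2 := ((integrable_sum_comp_iterate hTm hV (N n)).sub (integrable_const v)).abs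
  have e1 : ∫ x, Real.exp (-(τ n ^ 2 / 2 * ∑ k ∈ Finset.range (N n), V (T^[k] x))) ∂μ -
      Real.exp (-(w / 2 * v)) =
      ∫ x, (Real.exp (-(τ n ^ 2 / 2 * ∑ k ∈ Finset.range (N n), V (T^[k] x))) -
        Real.exp (-(w / 2 * v))) ∂μ := by
    rw [integral_sub i1 (integrable_const _)]
    simp
  rw [e1]
  refine (norm_integral_le_integral_norm _).trans ?_
  have e2 : ∫ x, ((N n * τ n ^ 2) / 2 *
      |(N n : ℝ)⁻¹ * ∑ k ∈ Finset.range (N n), V (T^[k] x) - v| +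
      |(N n * τ n ^ 2) / 2 - w / 2| * v) ∂μ = (N n * τ n ^ 2) / 2 *
      (∫ x, |(N n : ℝ)⁻¹ * ∑ k ∈ Finset.range (N n), V (T^[k] x) - v| ∂μ) +
      |(N n * τ n ^ 2) / 2 - w / 2| * v := by
    rw [integral_add (by exact i2.const_mul _) (integrable_const _), integral_const_mul]
    simp
  rw [← e2]
  refine integral_mono (i1.sub (integrable_const _)).norm
    ((i2.const_mul _).add (integrable_const _)) fun x => ?_
  have hx := hS0 x
  refine (abs_exp_neg_sub_exp_neg_le (by positivity) (by positivity)).trans ?_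
  have e3 : τ n ^ 2 / 2 * ∑ k ∈ Finset.range (N n), V (T^[k] x) - w / 2 * v =
      (N n * τ n ^ 2) / 2 * ((N n : ℝ)⁻¹ * ∑ k ∈ Finset.range (N n), V (T^[k] x) - v) +
        ((N n * τ n ^ 2) / 2 - w / 2) * v := by
    field_simp
    ring
  rw [e3]
  refine (abs_add_le _ _).trans (le_of_eq ?_)
  rw [abs_mul, abs_mul, abs_of_nonneg hv0, abs_of_nonneg (by positivity : 0 ≤ N n * τ n ^ 2 / 2)]

/-- A central limit theorem for stationary ergodic sequences admitting Lindeberg schemes. -/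
theorem tendsto_integral_exp_sum (hT : Ergodic T μ) {D V : Ω → ℝ} (hD : MemLp D 2 μ)
    (hV : Integrable V μ) (hV0 : ∀ x, 0 ≤ V x)
    (hG : ∀ N, ∃ G : ℕ → MeasurableSpace Ω, LindebergScheme μ T D V N G)
    {N : ℕ → ℕ} {τ : ℕ → ℝ} {w : ℝ} (hN : Tendsto N atTop atTop)
    (hτ : Tendsto (fun n => N n * τ n ^ 2) atTop (𝓝 w)) :
    Tendsto (fun n => ∫ x, Complex.exp
      (Complex.I * (τ n * ∑ k ∈ Finset.range (N n), D (T^[k] x) : ℝ)) ∂μ)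
      atTop (𝓝 (Real.exp (-(w / 2 * ∫ x, V x ∂μ)) : ℂ)) := by
  have h1 := (Complex.continuous_ofReal.tendsto _).comp
    (tendsto_integral_exp_ergodicSum hT hV hV0 hN hτ)
  have h2 := tendsto_mul_integral_stepError hD hV hV0 hN hτ
  have h3 : Tendsto (fun n => ∫ x, Complex.exp
      (Complex.I * (τ n * ∑ k ∈ Finset.range (N n), D (T^[k] x) : ℝ)) ∂μ -
      ∫ x, (Real.exp (-(τ n ^ 2 / 2 * ∑ k ∈ Finset.range (N n), V (T^[k] x))) : ℂ) ∂μ)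
      atTop (𝓝 0) := by
    refine squeeze_zero_norm (fun n => ?_) h2
    obtain ⟨G, hG⟩ := hG (N n)
    exact hG.norm_integral_sub_le hT.toMeasurePreserving hD hV hV0 (τ n)
  refine (h3.add h1).congr (fun n => ?_) |>.trans (by simp)
  simp only [Function.comp_apply]
  rw [← integral_complex_ofReal]
  ring

end CentralLimit

section Shift

variable {S : Type*}

/-- The coordinate process on path space. -/
abbrev coord (k : ℤ) (x : ℤ → S) : S := x k

theorem shift_iterate_apply (j : ℕ) (x : ℤ → S) (k : ℤ) : (shift^[j] x) k = x (k + j) := by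
  induction j generalizing x with
  | zero => simp
  | succ j ih =>
    rw [Function.iterate_succ_apply, ih]
    simp only [shift]
    congr 1
    push_cast
    ring

variable [MeasurableSpace S]

theorem comap_shift_iterate_comap_coord (j : ℕ) (k : ℤ) :
    (MeasurableSpace.comap (coord (S := S) k) inferInstance).comap shift^[j] =
      MeasurableSpace.comap (coord (k + j)) inferInstance := by
  rw [MeasurableSpace.comap_comp]
  congr 1
  funext x
  exact shift_iterate_apply j x k

theorem comap_shift_iterate_pairSigma (j : ℕ) (a b : ℤ) :
    (pairSigma (coord (S := S)) a b).comap shift^[j] = pairSigma coord (a + j) (b + j) := by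
  rw [pairSigma, MeasurableSpace.comap_sup, comap_shift_iterate_comap_coord,
    comap_shift_iterate_comap_coord]

theorem comap_shift_iterate_window_le (j : ℕ) (a b : ℤ) :
    (window (coord (S := S)) a b).comap shift^[j] ≤ window coord (a + j) (b + j) := by
  simp only [window, MeasurableSpace.comap_iSup]
  refine iSup₂_le fun k hk => ?_
  rw [comap_shift_iterate_comap_coord]
  exact comap_le_window (by linarith [hk.1]) (by linarith [hk.2])

theorem stronglyMeasurable_comp_shift_iterate {a b : ℤ} {Y : (ℤ → S) → ℝ}
    (hY : StronglyMeasurable[window coord a b] Y) (j : ℕ) :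
    StronglyMeasurable[window coord (a + j) (b + j)] fun x => Y (shift^[j] x) :=
  (hY.comp_measurable (comap_measurable _)).mono (comap_shift_iterate_window_le j a b)

theorem measurable_coord (k : ℤ) : Measurable (coord (S := S) k) := measurable_pi_apply k

theorem pathLaw_coord (P : Measure (ℤ → S)) : pathLaw P coord = P := Measure.map_id

end Shift

section PathSpace

variable {S : Type*} [MeasurableSpace S] {P : Measure (ℤ → S)} {f : S → ℝ}

theorem IsStationaryMarkovChain.measurePreserving_shift (hP : IsStationaryMarkovChain P coord) :
    MeasurePreserving shift P P := by
  have := hP.stationary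
  rwa [pathLaw_coord] at this

theorem stronglyMeasurable_coord_window (hf : Measurable f) {a b k : ℤ} (h1 : a ≤ k)
    (h2 : k ≤ b) : StronglyMeasurable[window coord a b] fun x : ℤ → S => f (x k) :=
  (hf.comp (comap_measurable (coord k))).stronglyMeasurable.mono (comap_le_window h1 h2)

theorem stronglyMeasurable_partialSum (hf : Measurable f) (n : ℕ) :
    StronglyMeasurable[window coord 0 n] (partialSum f (coord (S := S)) n) := by
  refine Finset.stronglyMeasurable_fun_sum _ fun i hi => ?_
  exact stronglyMeasurable_coord_window hf (by omega)
    (by exact_mod_cast (Finset.mem_Icc.1 hi).2)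

theorem stronglyMeasurable_centeredSum (hf : Measurable f) (n : ℕ) :
    StronglyMeasurable[window coord 0 n] (centeredSum P f coord n) :=
  (stronglyMeasurable_partialSum hf n).sub
    (stronglyMeasurable_condExp.mono (pairSigma_le_window (by omega)))

theorem memLp_partialSum (hP : IsStationaryMarkovChain P coord)
    (hf2 : MemLp (fun x => f (x 0)) 2 P) (n : ℕ) : MemLp (partialSum f coord n) 2 P := by
  refine memLp_finsetSum _ fun i _ => ?_
  have := hf2.comp_measurePreserving (hP.measurePreserving_shift.iterate i)
  simpa [Function.comp_def, shift_iterate_apply] using this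

/-- Subtracting a block leaves a variable that does not depend on the interior of the block. -/
theorem stronglyMeasurable_centeredSum_sub (hf : Measurable f) {n m j : ℕ} (h : j + m ≤ n) :
    StronglyMeasurable[past coord j ⊔ window coord (j + m) n] fun x =>
      centeredSum P f coord n x - centeredSum P f coord m (shift^[j] x) := by
  have e : ∀ x : ℤ → S, centeredSum P f coord n x - centeredSum P f coord m (shift^[j] x) =
      ∑ i ∈ Finset.Icc 1 n \ Finset.Icc (1 + j) (m + j), f (x i) +
        ((P[partialSum f coord m | pairSigma coord 0 (m : ℤ)]) (shift^[j] x) -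
        (P[partialSum f coord n | pairSigma coord 0 (n : ℤ)]) x) := by
    intro x
    have hsub : Finset.Icc (1 + j) (m + j) ⊆ Finset.Icc 1 n :=
      Finset.Icc_subset_Icc (by omega) (by omega)
    have h1 := Finset.sum_sdiff (f := fun i : ℕ => f (x i)) hsub
    have h2 : partialSum f coord m (shift^[j] x) =
        ∑ i ∈ Finset.Icc (1 + j) (m + j), f (x i) := by
      rw [← Finset.image_add_right_Icc, Finset.sum_image (by simp)]
      simp [partialSum, coord, shift_iterate_apply]
    have h3 : partialSum f coord n x = ∑ i ∈ Finset.Icc 1 n, f (x i) := rfl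
    simp only [centeredSum]
    rw [h2, h3, ← h1]
    ring
  simp_rw [e]
  refine StronglyMeasurable.add (Finset.stronglyMeasurable_fun_sum _ fun i hi => ?_)
    (StronglyMeasurable.sub ?_ ?_)
  · simp only [Finset.mem_sdiff, Finset.mem_Icc] at hi
    refine (hf.comp (comap_measurable (coord (i : ℤ)))).stronglyMeasurable.mono ?_
    rcases le_or_gt i j with hij | hij
    · exact (comap_le_past (by omega)).trans le_sup_left
    · exact (comap_le_window (by omega) (by omega)).trans le_sup_right
  · have h1 : StronglyMeasurable[(pairSigma coord 0 (m : ℤ)).comap shift^[j]]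
        fun x => (P[partialSum f coord m | pairSigma coord 0 (m : ℤ)]) (shift^[j] x) :=
      stronglyMeasurable_condExp.comp_measurable (comap_measurable _)
    rw [comap_shift_iterate_pairSigma] at h1
    refine h1.mono (sup_le ((comap_le_past (by omega)).trans le_sup_left)
      ((comap_le_window (by omega) (by omega)).trans le_sup_right))
  · exact stronglyMeasurable_condExp.mono (sup_le ((comap_le_past (by omega)).trans le_sup_left)
      ((comap_le_window (by omega) (by omega)).trans le_sup_right))

theorem integral_sq_eq_add_of_orthogonal {Ω : Type*} [MeasurableSpace Ω] {μ : Measure Ω}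
    {R Z : Ω → ℝ} (hR : MemLp R 2 μ) (hZ : MemLp Z 2 μ)
    (h : ∫ x, (R x - Z x) * Z x ∂μ = 0) :
    ∫ x, R x ^ 2 ∂μ = ∫ x, (R x - Z x) ^ 2 ∂μ + ∫ x, Z x ^ 2 ∂μ := by
  have hRZ : MemLp (fun x => R x - Z x) 2 μ := hR.sub hZ
  have i1 : Integrable (fun x => (R x - Z x) * Z x) μ := hRZ.integrable_mul hZ
  have e : ∀ x, R x ^ 2 = ((R x - Z x) ^ 2 + Z x ^ 2) + 2 * ((R x - Z x) * Z x) := fun x => by ring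
  simp_rw [e]
  rw [integral_add (by exact hRZ.integrable_sq.add hZ.integrable_sq) (i1.const_mul 2),
    integral_add hRZ.integrable_sq hZ.integrable_sq, integral_const_mul, h]
  ring

theorem stronglyMeasurable_block_past (hf : Measurable f) {m j : ℕ} {n : ℤ} (h : (j : ℤ) + m ≤ n) :
    StronglyMeasurable[past coord n] fun x => centeredSum P f coord m (shift^[j] x) :=
  (stronglyMeasurable_comp_shift_iterate (stronglyMeasurable_centeredSum hf m) j).mono
    (window_le_past (by omega))

theorem memLp_centeredSum (hP : IsStationaryMarkovChain P coord)
    (hf2 : MemLp (fun x => f (x 0)) 2 P) (n : ℕ) : MemLp (centeredSum P f coord n) 2 P :=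
  (memLp_partialSum hP hf2 n).sub ((memLp_partialSum hP hf2 n).condExp one_le_two)

theorem memLp_centeredSum_comp_shift (hP : IsStationaryMarkovChain P coord)
    (hf2 : MemLp (fun x => f (x 0)) 2 P) (n j : ℕ) :
    MemLp (fun x => centeredSum P f coord n (shift^[j] x)) 2 P :=
  (memLp_centeredSum hP hf2 n).comp_measurePreserving (hP.measurePreserving_shift.iterate j)

/-- The second moment of the randomly centered sums. -/
noncomputable def energy (P : Measure (ℤ → S)) (f : S → ℝ) (n : ℕ) : ℝ :=
  ∫ x, centeredSum P f coord n x ^ 2 ∂P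

theorem integral_sq_centeredSum_comp_shift (hP : IsStationaryMarkovChain P coord)
    (hf2 : MemLp (fun x => f (x 0)) 2 P) (m j : ℕ) :
    ∫ x, centeredSum P f coord m (shift^[j] x) ^ 2 ∂P = energy P f m :=
  integral_comp_measurePreserving (hP.measurePreserving_shift.iterate j)
    (h := fun x => centeredSum P f coord m x ^ 2)
    (memLp_centeredSum hP hf2 m).integrable_sq.aestronglyMeasurable

variable [IsProbabilityMeasure P]

theorem IsStationaryMarkovChain.condExp_comp_shift_iterate (hP : IsStationaryMarkovChain P coord)
    {m : ℕ} {Y : (ℤ → S) → ℝ} (hY : StronglyMeasurable[window coord 0 m] Y)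
    (hYi : Integrable Y P) (j : ℕ) {c : ℤ} (hc : (j : ℤ) + m ≤ c) :
    P[fun x => Y (shift^[j] x) | past coord j ⊔ window coord (j + m) c] =ᵐ[P]
      fun x => (P[Y | pairSigma coord 0 m]) (shift^[j] x) := by
  have hT := hP.measurePreserving_shift.iterate j
  have h1 : StronglyMeasurable[window coord j (j + m)] fun x => Y (shift^[j] x) := by
    have := stronglyMeasurable_comp_shift_iterate hY j
    rwa [zero_add, add_comm (m : ℤ)] at this
  refine (hP.condExpAgree_two_sided (by omega) hc _ h1
    (hT.integrable_comp_of_integrable hYi)).trans ?_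
  have h2 := condExp_comp_measurePreserving hT (pairSigma_le measurable_coord 0 m) hYi
  rw [comap_shift_iterate_pairSigma, zero_add, add_comm (m : ℤ)] at h2
  exact h2

theorem condExp_centeredSum (hP : IsStationaryMarkovChain P coord)
    (hf2 : MemLp (fun x => f (x 0)) 2 P) (n : ℕ) :
    P[centeredSum P f coord n | pairSigma coord 0 n] =ᵐ[P] 0 := by
  have hi := (memLp_partialSum hP hf2 n).integrable one_le_two
  refine (condExp_sub hi integrable_condExp _).trans ?_
  rw [condExp_of_stronglyMeasurable (f := P[partialSum f coord n | pairSigma coord 0 n])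
    (pairSigma_le measurable_coord 0 n) stronglyMeasurable_condExp integrable_condExp, sub_self]

theorem condExp_centeredSum_comp_shift (hP : IsStationaryMarkovChain P coord) (hf : Measurable f)
    (hf2 : MemLp (fun x => f (x 0)) 2 P) (m j : ℕ) {c : ℤ} (hc : (j : ℤ) + m ≤ c) :
    P[fun x => centeredSum P f coord m (shift^[j] x) |
      past coord j ⊔ window coord (j + m) c] =ᵐ[P] 0 := by
  refine (hP.condExp_comp_shift_iterate (stronglyMeasurable_centeredSum hf m)
    ((memLp_centeredSum hP hf2 m).integrable one_le_two) j hc).trans ?_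
  exact (hP.measurePreserving_shift.iterate j).quasiMeasurePreserving.ae
    (condExp_centeredSum hP hf2 m)

theorem integral_mul_centeredSum_comp_shift (hP : IsStationaryMarkovChain P coord)
    (hf : Measurable f) (hf2 : MemLp (fun x => f (x 0)) 2 P) (m j : ℕ) {c : ℤ}
    (hc : (j : ℤ) + m ≤ c) {Y : (ℤ → S) → ℝ}
    (hY : StronglyMeasurable[past coord j ⊔ window coord (j + m) c] Y) (hY2 : MemLp Y 2 P) :
    ∫ x, Y x * centeredSum P f coord m (shift^[j] x) ∂P = 0 :=
  integral_mul_eq_zero_of_condExp_eq_zero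
    (sup_le (past_le measurable_coord _) (window_le measurable_coord _ _)) hY
    ((memLp_centeredSum_comp_shift hP hf2 m j).integrable one_le_two)
    (hY2.integrable_mul (memLp_centeredSum_comp_shift hP hf2 m j))
    (condExp_centeredSum_comp_shift hP hf hf2 m j hc)

theorem energy_add_le (hP : IsStationaryMarkovChain P coord) (hf : Measurable f)
    (hf2 : MemLp (fun x => f (x 0)) 2 P) (n m : ℕ) :
    energy P f n + energy P f m ≤ energy P f (n + m) := by
  have hA := memLp_centeredSum hP hf2 (n + m)
  have hB := memLp_centeredSum hP hf2 n
  have hC := memLp_centeredSum_comp_shift hP hf2 m n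
  have hR : MemLp (fun x => centeredSum P f coord (n + m) x - centeredSum P f coord n x) 2 P :=
    hA.sub hB
  have e1 := integral_sq_eq_add_of_orthogonal hA hB <| by
    have := integral_mul_centeredSum_comp_shift hP hf hf2 n 0 (c := (n + m : ℕ)) (by simp)
      (stronglyMeasurable_centeredSum_sub (P := P) hf (j := 0) (by omega)) (hA.sub hB)
    simpa using this
  have e2 := integral_sq_eq_add_of_orthogonal hR hC <| by
    have hm : StronglyMeasurable[past coord n ⊔ window coord (n + m) (n + m : ℕ)] fun x =>
        centeredSum P f coord (n + m) x - centeredSum P f coord n x -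
          centeredSum P f coord m (shift^[n] x) := by
      have h1 := stronglyMeasurable_centeredSum_sub (P := P) hf (n := n + m) (j := n) le_rfl
      have h2 : StronglyMeasurable[past coord (n : ℤ)] fun x => centeredSum P f coord n x :=
        stronglyMeasurable_block_past (j := 0) hf (by simp)
      convert h1.sub (h2.mono le_sup_left) using 1
      funext x
      exact sub_right_comm _ _ _
    exact integral_mul_centeredSum_comp_shift hP hf hf2 m n (by simp) hm (hR.sub hC)
  rw [integral_sq_centeredSum_comp_shift hP hf2] at e2
  have h0 : 0 ≤ ∫ x, (centeredSum P f coord (n + m) x - centeredSum P f coord n x -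
      centeredSum P f coord m (shift^[n] x)) ^ 2 ∂P := integral_nonneg fun x => sq_nonneg _
  simp only [energy] at *
  linarith

theorem integral_sq_centeredSum_sub_blocks (hP : IsStationaryMarkovChain P coord)
    (hf : Measurable f) (hf2 : MemLp (fun x => f (x 0)) 2 P) {n m N : ℕ} (h : m * N ≤ n) :
    ∫ x, (centeredSum P f coord n x -
      ∑ k ∈ Finset.range N, centeredSum P f coord m (shift^[m * k] x)) ^ 2 ∂P =
      energy P f n - N * energy P f m := by
  induction N with
  | zero => simp [energy]
  | succ N ih =>
    have hN : m * N + m ≤ n := by rwa [← Nat.mul_succ]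
    have hA := memLp_centeredSum hP hf2 n
    have hZ : ∀ k, MemLp (fun x => centeredSum P f coord m (shift^[m * k] x)) 2 P := fun k =>
      memLp_centeredSum_comp_shift hP hf2 m (m * k)
    have hs : MemLp (fun x =>
        ∑ k ∈ Finset.range N, centeredSum P f coord m (shift^[m * k] x)) 2 P :=
      memLp_finsetSum _ fun k _ => hZ k
    have hR : MemLp (fun x => centeredSum P f coord n x -
      ∑ k ∈ Finset.range N, centeredSum P f coord m (shift^[m * k] x)) 2 P := hA.sub hs
    have e := integral_sq_eq_add_of_orthogonal hR (hZ N) <| by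
      have h1 := stronglyMeasurable_centeredSum_sub (P := P) hf (n := n) (j := m * N) hN
      have h2 : StronglyMeasurable[past coord (m * N : ℕ)] fun x =>
          ∑ k ∈ Finset.range N, centeredSum P f coord m (shift^[m * k] x) :=
        Finset.stronglyMeasurable_fun_sum _ fun k hk => stronglyMeasurable_block_past hf <| by
          have : m * (k + 1) ≤ m * N := Nat.mul_le_mul_left m (Finset.mem_range.1 hk)
          rw [Nat.mul_succ] at this
          exact_mod_cast this
      refine integral_mul_centeredSum_comp_shift hP hf hf2 m (m * N) (c := n)
        (by exact_mod_cast hN) ?_ (hR.sub (hZ N))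
      convert h1.sub (h2.mono le_sup_left) using 1
      funext x
      exact sub_right_comm _ _ _
    rw [ih (by omega), integral_sq_centeredSum_comp_shift hP hf2] at e
    simp only [Finset.sum_range_succ]
    simp_rw [← sub_sub]
    push_cast
    linarith

theorem energy_le (hP : IsStationaryMarkovChain P coord) (hf2 : MemLp (fun x => f (x 0)) 2 P)
    (n : ℕ) : energy P f n ≤ ∫ x, partialSum f coord n x ^ 2 ∂P := by
  have hm := pairSigma_le (measurable_coord (S := S)) 0 n
  have hX := memLp_partialSum hP hf2 n
  have h := integral_mono_ae integrable_condVar integrable_condExp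
    (condVar_ae_le_condExp_sq hm hX)
  rw [condVar, integral_condExp hm, integral_condExp hm] at h
  exact h

theorem exists_tendsto_energy_div (hP : IsStationaryMarkovChain P coord) (hf : Measurable f)
    (hf2 : MemLp (fun x => f (x 0)) 2 P) {C : ℝ}
    (hC : ∀ n : ℕ, 1 ≤ n → (∫ x, partialSum f coord n x ^ 2 ∂P) / n ≤ C) :
    ∃ s : ℝ≥0, Tendsto (fun n : ℕ => energy P f n / n) atTop (𝓝 s) := by
  have hsub : Subadditive fun n => -energy P f n := fun n m => by
    have := energy_add_le hP hf hf2 n m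
    linarith
  have hlim := (hsub.tendsto_lim ⟨-max C 0, by
    rintro _ ⟨n, rfl⟩
    rcases Nat.eq_zero_or_pos n with rfl | hn
    · simp
    have h1 := hC n hn
    have h2 : energy P f n / n ≤ (∫ x, partialSum f coord n x ^ 2 ∂P) / n := by
      gcongr
      exact energy_le hP hf2 n
    simp only [neg_div]
    have := le_max_left C 0
    linarith⟩).neg
  simp only [neg_div, neg_neg] at hlim
  have h0 : 0 ≤ -hsub.lim := ge_of_tendsto' hlim fun n => by
    have : 0 ≤ energy P f n := integral_nonneg fun x => sq_nonneg _
    positivity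
  exact ⟨⟨_, h0⟩, hlim⟩

end PathSpace

section PathCentralLimit

variable {S : Type*} [MeasurableSpace S] {P : Measure (ℤ → S)} {f : S → ℝ}

/-- A nonnegative version of the conditional second moment of a block. -/
noncomputable def blockVariance (P : Measure (ℤ → S)) (f : S → ℝ) (m : ℕ) (x : ℤ → S) : ℝ :=
  max ((P[fun y => centeredSum P f coord m y ^ 2 | pairSigma coord 0 (m : ℤ)]) x) 0

theorem blockVariance_nonneg (m : ℕ) (x : ℤ → S) : 0 ≤ blockVariance P f m x := le_max_right _ _

theorem stronglyMeasurable_blockVariance (m : ℕ) :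
    StronglyMeasurable[pairSigma coord 0 (m : ℤ)] (blockVariance P f m) :=
  (continuous_id.max continuous_const).comp_stronglyMeasurable stronglyMeasurable_condExp

theorem blockVariance_ae_eq (m : ℕ) : blockVariance P f m =ᵐ[P]
    P[fun y => centeredSum P f coord m y ^ 2 | pairSigma coord 0 (m : ℤ)] := by
  filter_upwards [condExp_nonneg (m := pairSigma coord 0 (m : ℤ)) (μ := P)
    (f := fun y => centeredSum P f coord m y ^ 2) (ae_of_all _ fun y => sq_nonneg _)] with x hx
  exact max_eq_left hx

theorem integrable_blockVariance (m : ℕ) : Integrable (blockVariance P f m) P :=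
  integrable_condExp.congr (blockVariance_ae_eq m).symm

theorem stronglyMeasurable_blockVariance_comp_shift (m j : ℕ) :
    StronglyMeasurable[pairSigma coord (j : ℤ) (j + m)]
      fun x => blockVariance P f m (shift^[j] x) := by
  have h : StronglyMeasurable[(pairSigma coord 0 (m : ℤ)).comap shift^[j]]
      fun x => blockVariance P f m (shift^[j] x) :=
    (stronglyMeasurable_blockVariance m).comp_measurable (comap_measurable _)
  rwa [comap_shift_iterate_pairSigma, zero_add, add_comm (m : ℤ)] at h

variable [IsProbabilityMeasure P]

theorem integral_blockVariance (m : ℕ) : ∫ x, blockVariance P f m x ∂P = energy P f m := by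
  rw [integral_congr_ae (blockVariance_ae_eq m),
    integral_condExp (pairSigma_le measurable_coord _ _)]
  rfl

theorem condExp_sq_sub_blockVariance_comp_shift (hP : IsStationaryMarkovChain P coord)
    (hf : Measurable f) (hf2 : MemLp (fun x => f (x 0)) 2 P) (m j : ℕ) {c : ℤ}
    (hc : (j : ℤ) + m ≤ c) :
    P[fun x => centeredSum P f coord m (shift^[j] x) ^ 2 - blockVariance P f m (shift^[j] x) |
      past coord j ⊔ window coord (j + m) c] =ᵐ[P] 0 := by
  have hT := hP.measurePreserving_shift.iterate j
  have hD2 := (memLp_centeredSum hP hf2 m).integrable_sq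
  have hVi := hT.integrable_comp_of_integrable (integrable_blockVariance (P := P) (f := f) m)
  have h1 := hP.condExp_comp_shift_iterate ((stronglyMeasurable_centeredSum hf m).pow 2) hD2 j hc
  have hle : past coord (j : ℤ) ⊔ window coord (j + m) c ≤
      (inferInstance : MeasurableSpace (ℤ → S)) :=
    sup_le (past_le measurable_coord _) (window_le measurable_coord _ _)
  have h2 : P[blockVariance P f m ∘ shift^[j] | past coord j ⊔ window coord (j + m) c] =
      blockVariance P f m ∘ shift^[j] :=
    condExp_of_stronglyMeasurable hle ((stronglyMeasurable_blockVariance_comp_shift m j).mono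
      (sup_le ((comap_le_past le_rfl).trans le_sup_left)
        ((comap_le_window le_rfl hc).trans le_sup_right))) hVi
  refine (condExp_sub (hT.integrable_comp_of_integrable hD2) hVi _).trans ?_
  rw [h2]
  filter_upwards [h1, hT.quasiMeasurePreserving.ae (blockVariance_ae_eq (P := P) (f := f) m)]
    with x hx hx2
  simp only [Pi.sub_apply, Function.comp_apply, Pi.zero_apply]
  rw [hx2]
  exact sub_eq_zero.2 hx

theorem lindebergScheme_blocks (hP : IsStationaryMarkovChain P coord) (hf : Measurable f)
    (hf2 : MemLp (fun x => f (x 0)) 2 P) (m N : ℕ) :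
    LindebergScheme P shift^[m] (centeredSum P f coord m) (blockVariance P f m) N
      fun k => past coord ((m * k : ℕ) : ℤ) ⊔ window coord ((m * k : ℕ) + m) ((m * N : ℕ) : ℤ) := by
  have hlt : ∀ {j k : ℕ}, j < k → ((m * j : ℕ) : ℤ) + m ≤ ((m * k : ℕ) : ℤ) := by
    intro j k hjk
    have : m * (j + 1) ≤ m * k := Nat.mul_le_mul_left m hjk
    rw [Nat.mul_succ] at this
    exact_mod_cast this
  constructor
  · exact fun k _ => sup_le (past_le measurable_coord _) (window_le measurable_coord _ _)
  · intro k j hj _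
    simp only [← Function.iterate_mul]
    exact (stronglyMeasurable_block_past hf (hlt hj)).mono le_sup_left
  · intro k j hj hjN
    simp only [← Function.iterate_mul]
    refine (stronglyMeasurable_blockVariance_comp_shift m (m * j)).mono (le_sup_of_le_right ?_)
    exact (pairSigma_le_window (by omega)).trans (window_mono (hlt hj) (hlt hjN))
  · intro k hk
    simp only [← Function.iterate_mul]
    exact condExp_centeredSum_comp_shift hP hf hf2 m (m * k) (hlt hk)
  · intro k hk
    simp only [← Function.iterate_mul]
    exact condExp_sq_sub_blockVariance_comp_shift hP hf hf2 m (m * k) (hlt hk)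

theorem tendsto_natCast_div_div (m : ℕ) :
    Tendsto (fun n : ℕ => ((n / m : ℕ) : ℝ) / n) atTop (𝓝 (m : ℝ)⁻¹) := by
  have h := (tendsto_nat_floor_mul_div_atTop (R := ℝ) (a := (m : ℝ)⁻¹) (by positivity)).comp
    tendsto_natCast_atTop_atTop
  refine h.congr fun n => ?_
  simp only [Function.comp_apply]
  rw [inv_mul_eq_div, Nat.floor_div_natCast, Nat.floor_natCast]

theorem norm_integral_exp_sub_le {Ω : Type*} [MeasurableSpace Ω] {μ : Measure Ω}
    [IsProbabilityMeasure μ] {A B : Ω → ℝ} (hA : MemLp A 2 μ) (hB : MemLp B 2 μ) (τ : ℝ) :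
    ‖∫ x, Complex.exp (Complex.I * (τ * A x : ℝ)) ∂μ -
      ∫ x, Complex.exp (Complex.I * (τ * B x : ℝ)) ∂μ‖ ≤
      |τ| * √(∫ x, (A x - B x) ^ 2 ∂μ) := by
  have hexp : Measurable fun y : ℝ => Complex.exp (Complex.I * (τ * y : ℝ)) := by fun_prop
  have hnorm : ∀ y : ℝ, ‖Complex.exp (Complex.I * (y : ℝ))‖ = 1 := fun y => by
    rw [mul_comm, Complex.norm_exp_ofReal_mul_I]
  have hi : ∀ {g : Ω → ℝ}, MemLp g 2 μ →
      Integrable (fun x => Complex.exp (Complex.I * (τ * g x : ℝ))) μ := fun {g} hg =>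
    Integrable.of_bound (C := 1)
      (hexp.comp_aemeasurable hg.aestronglyMeasurable.aemeasurable).aestronglyMeasurable
      (ae_of_all _ fun x => (hnorm _).le)
  have hAB : MemLp (fun x => A x - B x) 2 μ := hA.sub hB
  rw [← integral_sub (hi hA) (hi hB)]
  refine (norm_integral_le_integral_norm _).trans ?_
  refine le_trans ?_ (mul_le_mul_of_nonneg_left (integral_abs_le_sqrt hAB) (abs_nonneg τ))
  rw [← integral_const_mul]
  refine integral_mono ((hi hA).sub (hi hB)).norm
    (((hAB.integrable one_le_two).abs).const_mul _) fun x => ?_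
  have e : Complex.exp (Complex.I * (τ * A x : ℝ)) - Complex.exp (Complex.I * (τ * B x : ℝ)) =
      Complex.exp (Complex.I * (τ * B x : ℝ)) *
        (Complex.exp (Complex.I * (τ * (A x - B x) : ℝ)) - 1) := by
    rw [mul_sub, ← Complex.exp_add]
    push_cast
    ring_nf
  simp only [e, norm_mul, hnorm, one_mul]
  refine Real.norm_exp_I_mul_ofReal_sub_one_le.trans (le_of_eq ?_)
  rw [Real.norm_eq_abs, abs_mul]

theorem tendsto_charFun_centeredSum (hP : IsStationaryMarkovChain P coord)
    (herg : IsTotallyErgodic shift P) (hf : Measurable f)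
    (hf2 : MemLp (fun x => f (x 0)) 2 P) {s : ℝ}
    (hs : Tendsto (fun n : ℕ => energy P f n / n) atTop (𝓝 s)) (t : ℝ) :
    Tendsto (fun n : ℕ => ∫ x, Complex.exp
      (Complex.I * (t / √n * centeredSum P f coord n x : ℝ)) ∂P)
      atTop (𝓝 (Real.exp (-(t ^ 2 / 2 * s)) : ℂ)) := by
  set B : ℕ → ℝ := fun m => |t| * √(s - energy P f m / m) +
    |Real.exp (-(t ^ 2 / 2 * (energy P f m / m))) - Real.exp (-(t ^ 2 / 2 * s))| with hB
  have hBlim : Tendsto B atTop (𝓝 0) := by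
    have hc : Continuous fun y : ℝ => |t| * √(s - y) +
      |Real.exp (-(t ^ 2 / 2 * y)) - Real.exp (-(t ^ 2 / 2 * s))| := by fun_prop
    have h := (hc.tendsto s).comp hs
    simp only [sub_self, Real.sqrt_zero, mul_zero, abs_zero, add_zero] at h
    exact h
  rw [Metric.tendsto_nhds]
  intro ε hε
  obtain ⟨m, hmB, hm⟩ := ((hBlim.eventually_lt_const hε).and (eventually_ge_atTop 1)).exists
  have hm0 : (m : ℝ) ≠ 0 := by positivity
  have hT := herg m hm
  have hN : Tendsto (fun n => n / m) atTop atTop := Nat.tendsto_div_const_atTop (by omega)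
  have hτ : Tendsto (fun n : ℕ => ((n / m : ℕ) : ℝ) * (t / √n) ^ 2) atTop
      (𝓝 ((m : ℝ)⁻¹ * t ^ 2)) := by
    refine ((tendsto_natCast_div_div m).mul_const (t ^ 2)).congr fun n => ?_
    rw [div_pow, Real.sq_sqrt (Nat.cast_nonneg n)]
    ring
  have hclt := tendsto_integral_exp_sum hT (memLp_centeredSum hP hf2 m)
    (integrable_blockVariance m) (blockVariance_nonneg m)
    (fun N => ⟨_, lindebergScheme_blocks hP hf hf2 m N⟩) hN hτ
  rw [integral_blockVariance] at hclt
  have hexp : (m : ℝ)⁻¹ * t ^ 2 / 2 * energy P f m = t ^ 2 / 2 * (energy P f m / m) := by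
    field_simp
  rw [hexp] at hclt
  have hbound : Tendsto (fun n : ℕ => |t| * √(energy P f n / n -
      ((n / m : ℕ) : ℝ) / n * energy P f m) +
      ‖∫ x, Complex.exp (Complex.I * (t / √n * ∑ k ∈ Finset.range (n / m),
        centeredSum P f coord m ((shift^[m])^[k] x) : ℝ)) ∂P -
        (Real.exp (-(t ^ 2 / 2 * (energy P f m / m))) : ℂ)‖ +
      |Real.exp (-(t ^ 2 / 2 * (energy P f m / m))) - Real.exp (-(t ^ 2 / 2 * s))|)
      atTop (𝓝 (|t| * √(s - (m : ℝ)⁻¹ * energy P f m) + 0 +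
      |Real.exp (-(t ^ 2 / 2 * (energy P f m / m))) - Real.exp (-(t ^ 2 / 2 * s))|)) :=
    ((((hs.sub ((tendsto_natCast_div_div m).mul_const _)).sqrt).const_mul |t|).add
      (tendsto_iff_norm_sub_tendsto_zero.1 hclt)).add_const _
  rw [add_zero, inv_mul_eq_div] at hbound
  filter_upwards [hbound.eventually_lt_const hmB, eventually_gt_atTop 0] with n hn hn0
  refine lt_of_le_of_lt ?_ hn
  have hn0' : (0 : ℝ) < n := by exact_mod_cast hn0
  rw [dist_eq_norm]
  have hsum : MemLp (fun x => ∑ k ∈ Finset.range (n / m),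
      centeredSum P f coord m ((shift^[m])^[k] x)) 2 P :=
    memLp_finsetSum _ fun k _ =>
      (memLp_centeredSum hP hf2 m).comp_measurePreserving (hT.toMeasurePreserving.iterate k)
  have h1 := norm_integral_exp_sub_le (memLp_centeredSum hP hf2 n) hsum (t / √n)
  have h2 := integral_sq_centeredSum_sub_blocks hP hf hf2 (Nat.mul_div_le n m)
  simp only [Function.iterate_mul] at h2
  have h3 : |t / √n| * √(energy P f n - ((n / m : ℕ) : ℝ) * energy P f m) =
      |t| * √(energy P f n / n - ((n / m : ℕ) : ℝ) / n * energy P f m) := by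
    have : energy P f n / n - ((n / m : ℕ) : ℝ) / n * energy P f m =
        (energy P f n - ((n / m : ℕ) : ℝ) * energy P f m) / n := by ring
    rw [this, Real.sqrt_div' _ hn0'.le, abs_div, abs_of_nonneg (Real.sqrt_nonneg (n : ℝ))]
    ring
  rw [h2, h3] at h1
  refine (norm_sub_le_norm_sub_add_norm_sub _ (Real.exp (-(t ^ 2 / 2 * (energy P f m / m))) : ℂ)
    _).trans (add_le_add ((norm_sub_le_norm_sub_add_norm_sub _ _ _).trans
      (add_le_add h1 le_rfl)) (le_of_eq ?_))
  rw [← Complex.ofReal_sub, Complex.norm_real, Real.norm_eq_abs]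

end PathCentralLimit

section Transfer

variable {Ω S : Type*} [MeasurableSpace S] {ξ : ℤ → Ω → S}

/-- The trajectory map of a process. -/
def trajectory (ξ : ℤ → Ω → S) (ω : Ω) (k : ℤ) : S := ξ k ω

theorem comap_trajectory_comap_coord (k : ℤ) :
    (MeasurableSpace.comap (coord (S := S) k) inferInstance).comap (trajectory ξ) =
      MeasurableSpace.comap (ξ k) inferInstance := by
  rw [MeasurableSpace.comap_comp]
  rfl

theorem comap_trajectory_past (n : ℤ) :
    (past (coord (S := S)) n).comap (trajectory ξ) = past ξ n := by
  simp only [past, MeasurableSpace.comap_iSup, comap_trajectory_comap_coord]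

theorem comap_trajectory_pairSigma (i j : ℤ) :
    (pairSigma (coord (S := S)) i j).comap (trajectory ξ) = pairSigma ξ i j := by
  simp only [pairSigma, MeasurableSpace.comap_sup, comap_trajectory_comap_coord]

variable [MeasurableSpace Ω] {μ : Measure Ω}

theorem measurePreserving_trajectory (hξ : ∀ n, Measurable (ξ n)) :
    MeasurePreserving (trajectory ξ) μ (pathLaw μ ξ) :=
  ⟨measurable_pi_lambda _ hξ, rfl⟩

variable [IsProbabilityMeasure μ]

theorem isProbabilityMeasure_pathLaw (hξ : ∀ n, Measurable (ξ n)) :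
    IsProbabilityMeasure (pathLaw μ ξ) :=
  Measure.isProbabilityMeasure_map (measurePreserving_trajectory (μ := μ) hξ).aemeasurable

/-- The coordinate process is a stationary Markov chain under the path law. -/
theorem IsStationaryMarkovChain.coord_pathLaw (hξ : IsStationaryMarkovChain μ ξ) :
    IsStationaryMarkovChain (pathLaw μ ξ) coord := by
  have hΦ := measurePreserving_trajectory (μ := μ) hξ.measurable
  have := isProbabilityMeasure_pathLaw (μ := μ) hξ.measurable
  refine ⟨measurable_coord, by rw [pathLaw_coord]; exact hξ.stationary, fun n A hA => ?_⟩
  set g : (ℤ → S) → ℝ := (coord (n + 1) ⁻¹' A).indicator fun _ => 1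
  have hg : Integrable g (pathLaw μ ξ) :=
    integrable_indicator_one (measurable_coord (n + 1) hA)
  have h1 := condExp_comp_measurePreserving hΦ (past_le measurable_coord n) hg
  have h2 := condExp_comp_measurePreserving hΦ (measurable_coord n).comap_le hg
  rw [comap_trajectory_past] at h1
  rw [comap_trajectory_comap_coord] at h2
  have h3 := (h1.symm.trans (hξ.markov n A hA)).trans h2
  have hms : MeasurableSet {x | ((pathLaw μ ξ)[g | past coord n]) x =
      ((pathLaw μ ξ)[g | MeasurableSpace.comap (coord n) inferInstance]) x} :=
    measurableSet_eq_fun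
      (stronglyMeasurable_condExp.mono (past_le measurable_coord n)).measurable
      (stronglyMeasurable_condExp.mono (measurable_coord n).comap_le).measurable
  exact (ae_map_iff hΦ.aemeasurable hms).2 h3

theorem centeredSum_ae_eq_comp_trajectory (hξ : IsStationaryMarkovChain μ ξ) {f : S → ℝ}
    (hf2 : MemLp (fun x : ℤ → S => f (x 0)) 2 (pathLaw μ ξ)) (n : ℕ) :
    centeredSum μ f ξ n =ᵐ[μ] centeredSum (pathLaw μ ξ) f coord n ∘ trajectory ξ := by
  have hΦ := measurePreserving_trajectory (μ := μ) hξ.measurable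
  have := isProbabilityMeasure_pathLaw (μ := μ) hξ.measurable
  have h1 := condExp_comp_measurePreserving hΦ (pairSigma_le measurable_coord 0 (n : ℤ))
    ((memLp_partialSum hξ.coord_pathLaw hf2 n).integrable one_le_two)
  rw [comap_trajectory_pairSigma] at h1
  filter_upwards [h1] with ω hω
  exact congrArg (partialSum f ξ n ω - ·) hω

end Transfer

end RandomCentering

theorem theorem1 {Ω S : Type*} [MeasurableSpace Ω] [MeasurableSpace S]
    (μ : Measure Ω) [IsProbabilityMeasure μ] (ξ : ℤ → Ω → S)
    (hξ : RandomCentering.IsStationaryMarkovChain μ ξ)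
    (herg : RandomCentering.IsTotallyErgodic RandomCentering.shift
      (RandomCentering.pathLaw μ ξ))
    (f : S → ℝ) (hf : Measurable f) (hf2 : MemLp f 2 (μ.map (ξ 0)))
    (hf0 : ∫ x, f x ∂(μ.map (ξ 0)) = 0)
    (hvar : ∃ C : ℝ, ∀ n : ℕ, 1 ≤ n →
      (∫ ω, (RandomCentering.partialSum f ξ n ω) ^ 2 ∂μ) / (n : ℝ) ≤ C) :
    ∃ σ : ℝ≥0,
      Tendsto (fun n : ℕ => (1 / (n : ℝ)) * (lpNorm (RandomCentering.centeredSum μ f ξ n) 2 μ) ^ 2)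
        atTop (𝓝 ((σ : ℝ) ^ 2)) ∧
      TendstoInDistribution
        (fun (n : ℕ) ω => RandomCentering.centeredSum μ f ξ n ω / Real.sqrt (n : ℝ))
        atTop (id : ℝ → ℝ) (fun _ => μ) (gaussianReal 0 (σ ^ 2)) := by
  open RandomCentering in
  have hΦ := measurePreserving_trajectory (μ := μ) hξ.measurable
  have := isProbabilityMeasure_pathLaw (μ := μ) hξ.measurable
  have hP := hξ.coord_pathLaw
  have hf2' : MemLp (fun x : ℤ → S => f (x 0)) 2 (pathLaw μ ξ) := by
    have h0 : MeasurePreserving (fun x : ℤ → S => x 0) (pathLaw μ ξ) (μ.map (ξ 0)) :=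
      ⟨measurable_pi_apply 0, by
        rw [← hΦ.map_eq, Measure.map_map (measurable_pi_apply 0) hΦ.measurable]
        rfl⟩
    exact hf2.comp_measurePreserving h0
  obtain ⟨C, hC⟩ := hvar
  have hC' : ∀ n : ℕ, 1 ≤ n →
      (∫ x, partialSum f coord n x ^ 2 ∂(pathLaw μ ξ)) / n ≤ C := by
    intro n hn
    rw [← hΦ.map_eq, integral_map hΦ.aemeasurable]
    · exact hC n hn
    · rw [hΦ.map_eq]
      exact (memLp_partialSum hP hf2' n).integrable_sq.aestronglyMeasurable
  obtain ⟨s, hs⟩ := exists_tendsto_energy_div hP hf hf2' hC'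
  have hae := centeredSum_ae_eq_comp_trajectory hξ hf2'
  have hL2 : ∀ n, MemLp (centeredSum μ f ξ n) 2 μ := fun n =>
    (memLp_congr_ae (hae n)).2 ((memLp_centeredSum hP hf2' n).comp_measurePreserving hΦ)
  have henergy : ∀ n, lpNorm (centeredSum μ f ξ n) 2 μ ^ 2 = energy (pathLaw μ ξ) f n := by
    intro n
    have h1 := lpNorm_eq_integral_norm_rpow_toReal (p := 2) (by simp) (by simp) (hL2 n).1
    have h2 : 0 ≤ ∫ ω, centeredSum μ f ξ n ω ^ 2 ∂μ := integral_nonneg fun _ => sq_nonneg _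
    simp only [ENNReal.toReal_ofNat, Real.rpow_ofNat, Real.norm_eq_abs, sq_abs] at h1
    rw [h1, ← Real.rpow_natCast, ← Real.rpow_mul h2]
    norm_num
    have h3 := integral_map hΦ.aemeasurable (hΦ.map_eq.symm ▸
      (memLp_centeredSum hP hf2' n).integrable_sq.aestronglyMeasurable)
    rw [hΦ.map_eq] at h3
    rw [energy, h3]
    exact integral_congr_ae (by filter_upwards [hae n] with ω hω; rw [hω, Function.comp_apply])
  have hmeas : ∀ n : ℕ, AEMeasurable (fun ω => centeredSum μ f ξ n ω / √(n : ℝ)) μ := fun n =>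
    (hL2 n).aestronglyMeasurable.aemeasurable.div_const _
  have hsσ : (NNReal.sqrt s) ^ 2 = s := NNReal.sq_sqrt s
  refine ⟨NNReal.sqrt s, ?_, ⟨hmeas, aemeasurable_id, ?_⟩⟩
  · rw [← NNReal.coe_pow, hsσ]
    refine hs.congr fun n => ?_
    rw [henergy]
    ring
  · refine ProbabilityMeasure.tendsto_iff_tendsto_charFun.2 fun t => ?_
    simp only [ProbabilityMeasure.coe_mk, Measure.map_id, hsσ]
    rw [charFun_gaussianReal]
    have hlim := tendsto_charFun_centeredSum hP herg hf hf2' hs t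
    have hexp : (Real.exp (-(t ^ 2 / 2 * s)) : ℂ) =
        Complex.exp (t * (0 : ℝ) * Complex.I - s * t ^ 2 / 2) := by
      push_cast
      ring_nf
    rw [← hexp]
    refine hlim.congr fun n => ?_
    rw [charFun_apply_real, integral_map (hmeas n) (by fun_prop)]
    have hm : AEStronglyMeasurable (fun x => Complex.exp (Complex.I *
        (t / √n * centeredSum (pathLaw μ ξ) f coord n x : ℝ))) (pathLaw μ ξ) := by
      have := (memLp_centeredSum hP hf2' n).aestronglyMeasurable.aemeasurable
      exact AEMeasurable.aestronglyMeasurable (by fun_prop)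
    have h1 := integral_map hΦ.aemeasurable (hΦ.map_eq.symm ▸ hm)
    rw [hΦ.map_eq] at h1
    rw [h1]
    refine integral_congr_ae ?_
    filter_upwards [hae n] with ω hω
    rw [hω, Function.comp_apply]
    push_cast
    ring_nf
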